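/- For $m,n\ge 1$ let $\mathcal H(m)$ and $\mathcal S(n)$ be the real vector spaces of complex hermitian $m\times m$ and real symmetric $n\times n$ matrices, and let $H_+(m)$, $S_+(n)$ be the cones of positive semidefinite (PSD) matrices in them. Via the Kronecker product, $\mathcal H(m)\otimes_{\mathbb R}\mathcal S(n)$ is regarded as a subspace of $\mathcal H(mn)$; its elements are partitioned into $m\times m$ blocks $B_{\alpha\beta}$ of size $n\times n$. An element of $\mathcal H(m)\otimes\mathcal S(n)$ is called $H_+(m)\otimes S_+(n)$-separable if it is a finite sum $\sum_{l} p_l\,x_l\otimes x'_l$ with $p_l>0$, $x_l\in H_+(m)$, $x'_l\in S_+(n)$. It is called PPT if it is PSD and its partial transpose (obtained by exchanging the blocks $B_{\alpha\beta}$ and $B_{\beta\alpha}$ for all $\alpha\ne\beta$) is PSD. Let $\Sigma_{4,3}$ be the cone of $H_+(2)\otimes S_+(3)$-separable elements and $\Gamma_{4,3}$ the cone of PPT elements of $\mathcal H(2)\otimes\mathcal S(3)$. A face of a convex cone $K$ is a subset $F\subset K$ such that $x,y\in K$ and $\frac{x+y}{2}\in F$ imply $x,y\in F$. An extreme ray is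 a one-dimensional face, and its nonzero points are its generators. The blocks of $\mathbf B$ are called simultaneously diagonalizable if there is a real orthogonal matrix $U$ such that $UB_{\alpha\beta}U^T$ is diagonal for all $\alpha,\beta$. Theorem. (1) $\Gamma_{4,3}=\Sigma_{4,3}$. (2) An element of $\mathcal H(2)\otimes\mathcal S(3)$ is $H_+(2)\otimes S_+(3)$-separable if and only if it is PSD. (3) Let $\mathbf B$ generate an extreme ray of $\Gamma_{4,3}$. Then $\mathbf B$ has rank at most $3$. Moreover, for all linear automorphisms $g$ of $\mathcal H(2)$ and $g'$ of $\mathcal S(3)$ with $g[H_+(2)]=H_+(2)$ and $g'[S_+(3)]=S_+(3)$, the four blocks of $(g\otimes g')(\mathbf B)$ are simultaneously diagonalizable. In particular (with $g,g'$ the identities), the blocks of $\mathbf B$ itself are. (4) If $\mathbf B\in\Gamma_{4,3}$ has rank at most $3$ and is normalized such that its upper left $3\times 3$ block is $I_3$, then its four blocks are simultaneously diagonalizable. -/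

import Mathlib

open scoped TensorProduct Kronecker ComplexOrder

noncomputable section

/-! ### Separability, automorphisms of cones, faces and extreme rays -/

/-- `w ∈ E ⊗ E'` is `K ⊗ K'`-separable: `w = ∑ p_l x_l ⊗ x'_l` (finite sum) with
`p_l > 0`, `x_l ∈ K`, `x'_l ∈ K'`. -/
def IsSeparableTensor {E E' : Type*} [AddCommGroup E] [Module ℝ E]
    [AddCommGroup E'] [Module ℝ E'] (K : Set E) (K' : Set E') (w : E ⊗[ℝ] E') : Prop :=
  ∃ (N : ℕ) (p : Fin N → ℝ) (x : Fin N → E) (x' : Fin N → E'),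
    (∀ l, 0 < p l) ∧ (∀ l, x l ∈ K) ∧ (∀ l, x' l ∈ K') ∧
      w = ∑ l, p l • (x l ⊗ₜ[ℝ] x' l)

/-- The linear automorphism `g` of `E` is an automorphism of `K`, i.e. `g[K] = K`. -/
def IsConeAut {E : Type*} [AddCommGroup E] [Module ℝ E] (K : Set E) (g : E ≃ₗ[ℝ] E) : Prop :=
  g '' K = K

/-- `F` is a face of `K`: whenever a midpoint of two points of `K` is in `F`, both are in `F`. -/
def IsConeFace {V : Type*} [AddCommGroup V] [Module ℝ V] (K F : Set V) : Prop :=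
  F ⊆ K ∧ ∀ x ∈ K, ∀ y ∈ K, (1 / 2 : ℝ) • (x + y) ∈ F → x ∈ F ∧ y ∈ F

/-- An extreme ray of `K` is a one-dimensional face of `K`. -/
def IsExtremeRay {V : Type*} [AddCommGroup V] [Module ℝ V] (K R : Set V) : Prop :=
  IsConeFace K R ∧ Module.finrank ℝ (Submodule.span ℝ R) = 1

/-- `x` generates an extreme ray of `K`: it is a non-zero point on an extreme ray. -/
def GeneratesExtremeRay {V : Type*} [AddCommGroup V] [Module ℝ V] (K : Set V) (x : V) : Prop :=
  ∃ R : Set V, IsExtremeRay K R ∧ x ∈ R ∧ x ≠ 0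

/-! ### Matrix spaces and their positive semidefinite cones -/

/-- `H(m)`: the real vector space of complex hermitian `m × m` matrices. -/
abbrev HermSpace (m : ℕ) : Submodule ℝ (Matrix (Fin m) (Fin m) ℂ) :=
  selfAdjoint.submodule ℝ (Matrix (Fin m) (Fin m) ℂ)

/-- `S(n)`: the real vector space of real symmetric `n × n` matrices. -/
abbrev SymSpace (n : ℕ) : Submodule ℝ (Matrix (Fin n) (Fin n) ℝ) :=
  selfAdjoint.submodule ℝ (Matrix (Fin n) (Fin n) ℝ)

/-- `H₊(m)`. -/
def hermPSD (m : ℕ) : Set (HermSpace m) :=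
  {A | (A : Matrix (Fin m) (Fin m) ℂ).PosSemidef}

/-- `S₊(n)`. -/
def symPSD (n : ℕ) : Set (SymSpace n) :=
  {B | (B : Matrix (Fin n) (Fin n) ℝ).PosSemidef}

/-- The Kronecker representation of `H(m) ⊗ S(n)` by complex `mn × mn` matrices, determined by
`A ⊗ B ↦ A ⊗ₖ B`. Rows and columns are indexed by pairs `(α, i)`, where `α` is the number of the
block and `i` the position inside the block. -/
def kronRep (m n : ℕ) :
    (HermSpace m ⊗[ℝ] SymSpace n) →ₗ[ℝ] Matrix (Fin m × Fin n) (Fin m × Fin n) ℂ :=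
  TensorProduct.lift <| LinearMap.mk₂ ℝ
    (fun (A : HermSpace m) (B : SymSpace n) =>
      (A : Matrix (Fin m) (Fin m) ℂ) ⊗ₖ
        (B : Matrix (Fin n) (Fin n) ℝ).map (fun t : ℝ => (t : ℂ)))
    (by intro A₁ A₂ B; ext i j; simp [Matrix.kroneckerMap_apply, add_mul])
    (by intro c A B; ext i j; simp [Matrix.kroneckerMap_apply, mul_assoc])
    (by intro A B₁ B₂; ext i j; simp [Matrix.kroneckerMap_apply, mul_add])
    (by intro c A B; ext i j; simp [Matrix.kroneckerMap_apply, mul_left_comm])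

/-- The `(α, β)` block of size `n × n` of an `mn × mn` matrix. -/
def matBlock {m n : ℕ} (A : Matrix (Fin m × Fin n) (Fin m × Fin n) ℂ) (α β : Fin m) :
    Matrix (Fin n) (Fin n) ℂ :=
  Matrix.of fun i j => A (α, i) (β, j)

/-- The partial transpose `A^Γ`: the blocks `A_{αβ}` and `A_{βα}` are exchanged. -/
def partialTranspose {m n : ℕ} (A : Matrix (Fin m × Fin n) (Fin m × Fin n) ℂ) :
    Matrix (Fin m × Fin n) (Fin m × Fin n) ℂ :=
  Matrix.of fun p q => A (q.1, p.2) (p.1, q.2)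

/-- The PPT condition: `A` and `A^Γ` are (hermitian) positive semidefinite. -/
def IsPPT {m n : ℕ} (A : Matrix (Fin m × Fin n) (Fin m × Fin n) ℂ) : Prop :=
  A.PosSemidef ∧ (partialTranspose A).PosSemidef

/-! ### The cones `Σ_{4,n}` and `Γ_{4,n}` (where `E₄ = H(2)`, `K₄ = H₊(2)`) -/

/-- `Σ_{4,n}`: the cone of `H₊(2) ⊗ S₊(n)`-separable elements of `H(2) ⊗ S(n)`. -/
def Sigma4 (n : ℕ) : Set (HermSpace 2 ⊗[ℝ] SymSpace n) :=
  {w | IsSeparableTensor (hermPSD 2) (symPSD n) w}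

/-- `Γ_{4,n}`: the cone of PPT elements of `H(2) ⊗ S(n)`. -/
def Gamma4 (n : ℕ) : Set (HermSpace 2 ⊗[ℝ] SymSpace n) :=
  {w | IsPPT (kronRep 2 n w)}

/-- All blocks of `A` are simultaneously diagonalized by a real orthogonal congruence
`A_{αβ} ↦ U A_{αβ} Uᵀ`. -/
def BlocksSimultaneouslyDiagonalizable {m n : ℕ}
    (A : Matrix (Fin m × Fin n) (Fin m × Fin n) ℂ) : Prop :=
  ∃ U ∈ Matrix.orthogonalGroup (Fin n) ℝ, ∀ α β : Fin m,
    ((U.map fun t : ℝ => (t : ℂ)) * matBlock A α β *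
      (U.map fun t : ℝ => (t : ℂ)).transpose).IsDiag

end

/-! All blocks of an element are symmetric, so its partial transpose is its transpose and PPT means
PSD. The core is that a PSD matrix W with symmetric 3×3 blocks is separable, by induction on the
rank: if the range of W contains a product vector z ⊗ v with v real, a multiple of its projector can
be subtracted, keeping W PSD with symmetric blocks and lowering the rank
(`mem_sepCone_of_exists_tensorVec`).

A real congruence makes the upper left block a 0/1 diagonal matrix. In the main case it is I, the
off-diagonal blocks are C and C* = P ∓ iQ (P, Q real symmetric), and D is the lower right block. If
D = C*C, reality of D forces P and Q to commute; diagonalizing both exhibits W as separable.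
Otherwise some h = (D - C*C)x is nonzero and the range contains (tv, tC*v + sh) for all v, s, t; a
product vector arises once v, C*v, h are dependent. The determinant of these three is a complex
quadratic form in v, of trace zero because C* is symmetric. Its real and imaginary parts are two
traceless real forms in three variables, and such forms have a common real zero
(`exists_common_zero_of_trace_eq_zero`).

An extreme generator is then a single product x ⊗ y with y of rank one, and linear maps g ⊗ g' keep
it a product, whose blocks are multiples of one symmetric matrix. In the normalized low-rank case
the rank bound forces D = C*C, and again P and Q commute. -/

/-- Two commuting real symmetric matrices are diagonalized by a common orthogonal matrix. -/
theorem exists_orthogonal_diagonalizing_pair {n : ℕ} {P Q : Matrix (Fin n) (Fin n) ℝ}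
    (hP : P.IsSymm) (hQ : Q.IsSymm) (hPQ : Commute P Q) :
    ∃ U ∈ Matrix.orthogonalGroup (Fin n) ℝ, ∃ p q : Fin n → ℝ,
      P = U.transpose * Matrix.diagonal p * U ∧ Q = U.transpose * Matrix.diagonal q * U := by
  classical
  set A := Matrix.toEuclideanLin (𝕜 := ℝ) P
  set B := Matrix.toEuclideanLin (𝕜 := ℝ) Q
  have hA : A.IsSymmetric := Matrix.isSymmetric_toEuclideanLin_iff.2 (by
    rw [Matrix.IsHermitian, Matrix.conjTranspose_eq_transpose_of_trivial]; exact hP)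
  have hB : B.IsSymmetric := Matrix.isSymmetric_toEuclideanLin_iff.2 (by
    rw [Matrix.IsHermitian, Matrix.conjTranspose_eq_transpose_of_trivial]; exact hQ)
  have hAB : Commute A B := by
    ext v i
    have := congrArg (fun M => (M.mulVec v.ofLp) i) hPQ.eq
    simpa [A, B, Matrix.mulVec_mulVec] using this
  have hint := hA.directSum_isInternal_of_commute hB hAB
  have hort := hA.orthogonalFamily_eigenspace_inf_eigenspace hB
  -- The joint eigenspaces are indexed by all of ℝ × ℝ; only finitely many are nonzero, and an
  -- adapted orthonormal basis needs a finite index type. In an index the eigenvalue of `B` comes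
  -- first.
  have hfin := WellFoundedGT.finite_ne_bot_of_iSupIndep hint.submodule_iSupIndep
  have hint' := DirectSum.isInternal_ne_bot_iff.2 hint
  have : Fintype {i : ℝ × ℝ //
    (Module.End.eigenspace A i.2 ⊓ Module.End.eigenspace B i.1) ≠ ⊥} := hfin.fintype
  have hort' := hort.comp (γ := {i : ℝ × ℝ //
    (Module.End.eigenspace A i.2 ⊓ Module.End.eigenspace B i.1) ≠ ⊥}) Subtype.val_injective
  have hn : Module.finrank ℝ (EuclideanSpace ℝ (Fin n)) = n := by simp
  let b := hint'.subordinateOrthonormalBasis hn hort'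
  let idx := fun a => (hint'.subordinateOrthonormalBasisIndex hn a hort').1
  have hb : ∀ a, b a ∈ (Module.End.eigenspace A (idx a).2 ⊓ Module.End.eigenspace B (idx a).1) :=
    fun a => hint'.subordinateOrthonormalBasis_subordinate hn a hort'
  let U : Matrix (Fin n) (Fin n) ℝ := Matrix.of fun i j => b i j
  have hU : U * U.transpose = 1 := by
    ext i j
    have h := orthonormal_iff_ite.1 b.orthonormal i j
    simp only [PiLp.inner_apply, RCLike.inner_apply, conj_trivial] at h
    simp only [Matrix.mul_apply, Matrix.transpose_apply, Matrix.one_apply, U, Matrix.of_apply]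
    rw [← h]
    exact Finset.sum_congr rfl fun k _ => mul_comm _ _
  have hU' : U.transpose * U = 1 := mul_eq_one_comm.1 hU
  have key : ∀ (R : Matrix (Fin n) (Fin n) ℝ) (r : Fin n → ℝ),
      (∀ a, Matrix.toEuclideanLin (𝕜 := ℝ) R (b a) = r a • b a) →
      R = U.transpose * Matrix.diagonal r * U := by
    intro R r h
    have h1 : R * U.transpose = U.transpose * Matrix.diagonal r := by
      ext i a
      have h2 := congrArg (fun v : EuclideanSpace ℝ (Fin n) => v i) (h a)
      rw [Matrix.mul_diagonal, Matrix.mul_apply]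
      simp only [Matrix.transpose_apply, U, Matrix.of_apply]
      simpa [Matrix.mulVec, dotProduct, mul_comm] using h2
    rw [← h1, Matrix.mul_assoc, hU', Matrix.mul_one]
  refine ⟨U, (Matrix.mem_orthogonalGroup_iff _ _).2 hU, fun a => (idx a).2, fun a => (idx a).1,
    key P _ fun a => ?_, key Q _ fun a => ?_⟩
  · exact Module.End.mem_eigenspace_iff.1 (hb a).1
  · exact Module.End.mem_eigenspace_iff.1 (hb a).2

/-- Spectral theorem for real symmetric matrices. -/
theorem exists_orthogonal_diagonalizing {n : ℕ} {P : Matrix (Fin n) (Fin n) ℝ} (hP : P.IsSymm) :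
    ∃ U ∈ Matrix.orthogonalGroup (Fin n) ℝ, ∃ p : Fin n → ℝ,
      P = U.transpose * Matrix.diagonal p * U := by
  obtain ⟨U, hU, p, -, h, -⟩ := exists_orthogonal_diagonalizing_pair hP hP (Commute.refl P)
  exact ⟨U, hU, p, h⟩

/-- A real PSD matrix is congruent to a diagonal matrix with entries `0` and `1`. -/
theorem exists_congr_diagonal_zero_one {n : ℕ} {A : Matrix (Fin n) (Fin n) ℝ}
    (hA : A.PosSemidef) :
    ∃ S T : Matrix (Fin n) (Fin n) ℝ, ∃ e : Fin n → ℝ, S * T = 1 ∧ (∀ i, e i = 0 ∨ e i = 1) ∧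
      S * A * S.transpose = Matrix.diagonal e := by
  obtain ⟨U, hU, p, rfl⟩ := exists_orthogonal_diagonalizing (P := A) (by
    have := hA.isHermitian
    rwa [Matrix.IsHermitian, Matrix.conjTranspose_eq_transpose_of_trivial] at this)
  have hU1 : U * U.transpose = 1 := (Matrix.mem_orthogonalGroup_iff _ _).1 hU
  have hp : ∀ i, 0 ≤ p i := by
    intro i
    have h := hA.mul_mul_conjTranspose_same U
    have h2 : U * (U.transpose * Matrix.diagonal p * U) * U.transpose = Matrix.diagonal p := by
      rw [Matrix.mul_assoc, Matrix.mul_assoc _ U, hU1, Matrix.mul_one, ← Matrix.mul_assoc, hU1,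
        Matrix.one_mul]
    rw [Matrix.conjTranspose_eq_transpose_of_trivial, h2, Matrix.posSemidef_diagonal_iff] at h
    exact h i
  -- Kernel directions are scaled by 1, so that the congruence stays invertible.
  let s : Fin n → ℝ := fun i => if p i = 0 then 1 else (Real.sqrt (p i))⁻¹
  have hs : ∀ i, s i ≠ 0 := by
    intro i
    simp only [s]
    split_ifs with h
    · exact one_ne_zero
    · exact inv_ne_zero (Real.sqrt_ne_zero'.2 (lt_of_le_of_ne (hp i) (Ne.symm h)))
  refine ⟨Matrix.diagonal s * U, U.transpose * Matrix.diagonal (fun i => (s i)⁻¹),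
    fun i => if p i = 0 then 0 else 1, ?_, ?_, ?_⟩
  · rw [Matrix.mul_assoc, ← Matrix.mul_assoc U, hU1, Matrix.one_mul, Matrix.diagonal_mul_diagonal]
    simp [hs]
  · intro i
    by_cases h : p i = 0 <;> simp [h]
  · rw [Matrix.transpose_mul, Matrix.diagonal_transpose,
      show Matrix.diagonal s * U * (U.transpose * Matrix.diagonal p * U) *
        (U.transpose * Matrix.diagonal s) = Matrix.diagonal s * (U * U.transpose) *
        Matrix.diagonal p * (U * U.transpose) * Matrix.diagonal s by simp only [Matrix.mul_assoc],
      hU1, Matrix.mul_one, Matrix.mul_one, Matrix.diagonal_mul_diagonal,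
      Matrix.diagonal_mul_diagonal]
    congr 1
    funext i
    by_cases h : p i = 0
    · simp [h]
    · have h1 : 0 < p i := lt_of_le_of_ne (hp i) (Ne.symm h)
      have h2 := Real.mul_self_sqrt h1.le
      have h3 := Real.sqrt_ne_zero'.2 h1
      simp only [s, h, if_false]
      field_simp
      nlinarith

/-! ### Common zeros of two traceless real quadratic forms in three variables -/

theorem exists_zero_between {φ : ℝ → ℝ} (hφ : Continuous φ) (h : φ (-1) * φ 1 ≤ 0) :
    ∃ t, -1 ≤ t ∧ t ≤ 1 ∧ φ t = 0 := by
  have h11 : (-1 : ℝ) ≤ 1 := by norm_num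
  rcases mul_nonpos_iff.1 h with h | h
  · obtain ⟨t, ht, h0⟩ := intermediate_value_Icc' h11 hφ.continuousOn ⟨h.2, h.1⟩
    exact ⟨t, ht.1, ht.2, h0⟩
  · obtain ⟨t, ht, h0⟩ := intermediate_value_Icc h11 hφ.continuousOn ⟨h.1, h.2⟩
    exact ⟨t, ht.1, ht.2, h0⟩

/-- The cone contains the four points (±1, ±1, 1), where the values of `f` sum to zero. Adjacent
points are joined by a path on the cone, with z the positive square root, so the intermediate value
theorem applies unless all four values have the same strict sign. -/
theorem exists_zero_on_cone_aux {a b : ℝ} (ha : 0 ≤ a) (hb : 0 ≤ b) (hab : 0 < a + b)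
    {f : ℝ → ℝ → ℝ → ℝ} (hf : Continuous fun x : ℝ × ℝ × ℝ => f x.1 x.2.1 x.2.2)
    (hsum : f 1 1 1 + f (-1) 1 1 + f 1 (-1) 1 + f (-1) (-1) 1 = 0) :
    ∃ x y z : ℝ, (x ≠ 0 ∨ y ≠ 0 ∨ z ≠ 0) ∧ a * x ^ 2 + b * y ^ 2 = (a + b) * z ^ 2 ∧
      f x y z = 0 := by
  have hx : ∀ s : ℝ, s ^ 2 = 1 → f (-1) s 1 * f 1 s 1 ≤ 0 → ∃ x y z : ℝ,
      (x ≠ 0 ∨ y ≠ 0 ∨ z ≠ 0) ∧ a * x ^ 2 + b * y ^ 2 = (a + b) * z ^ 2 ∧ f x y z = 0 := by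
    intro s hs h
    obtain ⟨t, -, -, h0⟩ := exists_zero_between
      (φ := fun t => f t s (Real.sqrt ((a * t ^ 2 + b) / (a + b))))
      (hf.comp (g := fun x : ℝ × ℝ × ℝ => f x.1 x.2.1 x.2.2)
        (f := fun t => (t, s, Real.sqrt ((a * t ^ 2 + b) / (a + b)))) (by fun_prop))
      (by simpa [div_self hab.ne'] using h)
    refine ⟨t, s, _, Or.inr (Or.inl fun h => by simp [h] at hs), ?_, h0⟩
    rw [Real.sq_sqrt (by positivity), hs]
    field_simp
  have hy : ∀ s : ℝ, s ^ 2 = 1 → f s (-1) 1 * f s 1 1 ≤ 0 → ∃ x y z : ℝ,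
      (x ≠ 0 ∨ y ≠ 0 ∨ z ≠ 0) ∧ a * x ^ 2 + b * y ^ 2 = (a + b) * z ^ 2 ∧ f x y z = 0 := by
    intro s hs h
    obtain ⟨t, -, -, h0⟩ := exists_zero_between
      (φ := fun t => f s t (Real.sqrt ((a + b * t ^ 2) / (a + b))))
      (hf.comp (g := fun x : ℝ × ℝ × ℝ => f x.1 x.2.1 x.2.2)
        (f := fun t => (s, t, Real.sqrt ((a + b * t ^ 2) / (a + b)))) (by fun_prop))
      (by simpa [div_self hab.ne'] using h)
    refine ⟨s, t, _, Or.inl fun h => by simp [h] at hs, ?_, h0⟩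
    rw [Real.sq_sqrt (by positivity), hs]
    field_simp
  by_cases h1 : f (-1) 1 1 * f 1 1 1 ≤ 0
  · exact hx 1 (by norm_num) h1
  by_cases h2 : f (-1) (-1) 1 * f 1 (-1) 1 ≤ 0
  · exact hx (-1) (by norm_num) h2
  by_cases h3 : f 1 (-1) 1 * f 1 1 1 ≤ 0
  · exact hy 1 (by norm_num) h3
  -- The three edges tried connect all four corners, so the values now share one strict sign,
  -- against `hsum`.
  exfalso
  push Not at h1 h2 h3
  rcases pos_and_pos_or_neg_and_neg_of_mul_pos h1 with ⟨h, h'⟩ | ⟨h, h'⟩ <;>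
  rcases pos_and_pos_or_neg_and_neg_of_mul_pos h2 with ⟨g, g'⟩ | ⟨g, g'⟩ <;>
  rcases pos_and_pos_or_neg_and_neg_of_mul_pos h3 with ⟨k, k'⟩ | ⟨k, k'⟩ <;> linarith

theorem exists_zero_on_cone {a b : ℝ} (hab : 0 ≤ a * b)
    {f : ℝ → ℝ → ℝ → ℝ} (hf : Continuous fun x : ℝ × ℝ × ℝ => f x.1 x.2.1 x.2.2)
    (hsum : f 1 1 1 + f (-1) 1 1 + f 1 (-1) 1 + f (-1) (-1) 1 = 0) :
    ∃ x y z : ℝ, (x ≠ 0 ∨ y ≠ 0 ∨ z ≠ 0) ∧ a * x ^ 2 + b * y ^ 2 = (a + b) * z ^ 2 ∧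
      f x y z = 0 := by
  by_cases h0 : a = 0 ∧ b = 0
  · obtain ⟨x, y, z, h, -, h'⟩ := exists_zero_on_cone_aux zero_le_one zero_le_one
      (by norm_num) hf hsum
    exact ⟨x, y, z, h, by simp [h0.1, h0.2], h'⟩
  rcases mul_nonneg_iff.1 hab with ⟨ha, hb⟩ | ⟨ha, hb⟩
  · refine exists_zero_on_cone_aux ha hb (lt_of_le_of_ne (add_nonneg ha hb) fun h => h0 ?_) hf hsum
    constructor <;> linarith
  · obtain ⟨x, y, z, h, h1, h'⟩ := exists_zero_on_cone_aux (neg_nonneg.2 ha) (neg_nonneg.2 hb)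
      (lt_of_le_of_ne (by linarith) fun h => h0 (by constructor <;> linarith)) hf hsum
    exact ⟨x, y, z, h, by linarith, h'⟩

/-- The value at `v` of the quadratic form with matrix `G`. -/
theorem dotProduct_mulVec_fin_three (G : Matrix (Fin 3) (Fin 3) ℝ) (v : Fin 3 → ℝ) :
    v ⬝ᵥ G.mulVec v = G 0 0 * v 0 ^ 2 + G 1 1 * v 1 ^ 2 + G 2 2 * v 2 ^ 2 +
      (G 0 1 + G 1 0) * v 0 * v 1 + (G 0 2 + G 2 0) * v 0 * v 2 + (G 1 2 + G 2 1) * v 1 * v 2 := by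
  simp only [dotProduct, Matrix.mulVec, Fin.sum_univ_three]
  ring

/-- Two of the three `d i` have a nonnegative product; the third is minus their sum, so the zero set
of the diagonal form is the cone of `exists_zero_on_cone`. Over the four points (±1, ±1, 1) the
mixed terms of H cancel and its values add up to 4 tr H = 0. -/
theorem exists_common_zero_diagonal {d : Fin 3 → ℝ} (hd : d 0 + d 1 + d 2 = 0)
    {H : Matrix (Fin 3) (Fin 3) ℝ} (hH : H.trace = 0) :
    ∃ v : Fin 3 → ℝ, v ≠ 0 ∧ v ⬝ᵥ (Matrix.diagonal d).mulVec v = 0 ∧ v ⬝ᵥ H.mulVec v = 0 := by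
  have main : ∀ i j k : Fin 3, d i + d j + d k = 0 → (H i i + H j j + H k k = 0) →
      0 ≤ d i * d j → (∀ v : Fin 3 → ℝ, v ⬝ᵥ (Matrix.diagonal d).mulVec v =
        d i * v i ^ 2 + d j * v j ^ 2 + d k * v k ^ 2) →
      (∀ v : Fin 3 → ℝ, v ⬝ᵥ H.mulVec v = H i i * v i ^ 2 + H j j * v j ^ 2 + H k k * v k ^ 2 +
        (H i j + H j i) * v i * v j + (H i k + H k i) * v i * v k +
        (H j k + H k j) * v j * v k) →
      (∀ x y z : ℝ, ∃ v : Fin 3 → ℝ, v i = x ∧ v j = y ∧ v k = z) →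
      ∃ v : Fin 3 → ℝ, v ≠ 0 ∧ v ⬝ᵥ (Matrix.diagonal d).mulVec v = 0 ∧
        v ⬝ᵥ H.mulVec v = 0 := by
    intro i j k hs ht hij hD hF hv
    obtain ⟨x, y, z, h0, h1, h2⟩ := exists_zero_on_cone hij
      (f := fun x y z => H i i * x ^ 2 + H j j * y ^ 2 + H k k * z ^ 2 +
        (H i j + H j i) * x * y + (H i k + H k i) * x * z + (H j k + H k j) * y * z)
      (by fun_prop) (by linear_combination 4 * ht)
    obtain ⟨v, rfl, rfl, rfl⟩ := hv x y z
    refine ⟨v, ?_, ?_, ?_⟩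
    · rintro rfl
      simp at h0
    · rw [hD]
      linear_combination h1 + v k ^ 2 * hs
    · rw [hF]
      exact h2
  have hH' : H 0 0 + H 1 1 + H 2 2 = 0 := by
    rw [← hH, Matrix.trace_fin_three]
  have hD := dotProduct_mulVec_fin_three (Matrix.diagonal d)
  have hF := dotProduct_mulVec_fin_three H
  by_cases h01 : 0 ≤ d 0 * d 1
  · refine main 0 1 2 hd hH' h01 (fun v => by simp [hD]) hF fun x y z => ⟨![x, y, z], by simp⟩
  by_cases h02 : 0 ≤ d 0 * d 2
  · refine main 0 2 1 (by linarith) (by linarith) h02 (fun v => by simp [hD]; ring)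
      (fun v => by rw [hF]; ring) fun x y z => ⟨![x, z, y], by simp⟩
  by_cases h12 : 0 ≤ d 1 * d 2
  · refine main 1 2 0 (by linarith) (by linarith) h12 (fun v => by simp [hD]; ring)
      (fun v => by rw [hF]; ring) fun x y z => ⟨![z, x, y], by simp⟩
  exfalso
  push Not at h01 h02 h12
  have h3 := mul_pos_of_neg_of_neg h01 h02
  have h4 : d 0 * d 1 * (d 0 * d 2) = d 0 ^ 2 * (d 1 * d 2) := by ring
  rw [h4] at h3
  exact absurd h3 (not_lt.2 (mul_nonpos_of_nonneg_of_nonpos (sq_nonneg _) h12.le))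

/-- Two real quadratic forms in three variables of trace zero have a common nontrivial zero. -/
theorem exists_common_zero_of_trace_eq_zero {G H : Matrix (Fin 3) (Fin 3) ℝ}
    (hG : G.trace = 0) (hH : H.trace = 0) :
    ∃ v : Fin 3 → ℝ, v ≠ 0 ∧ v ⬝ᵥ G.mulVec v = 0 ∧ v ⬝ᵥ H.mulVec v = 0 := by
  -- The form of G + Gᵀ is twice that of G, and is diagonalizable even when G is not symmetric;
  -- orthogonal conjugation preserves both traces.
  obtain ⟨U, hU, d, hd⟩ := exists_orthogonal_diagonalizing (P := G + G.transpose) (by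
    rw [Matrix.IsSymm, Matrix.transpose_add, Matrix.transpose_transpose, add_comm])
  have hU1 : U * U.transpose = 1 := (Matrix.mem_orthogonalGroup_iff _ _).1 hU
  have hd0 : d 0 + d 1 + d 2 = 0 := by
    have h := congrArg Matrix.trace hd
    rw [Matrix.trace_mul_comm, ← Matrix.mul_assoc, hU1, Matrix.one_mul, Matrix.trace_add,
      Matrix.trace_transpose, hG, Matrix.trace_fin_three] at h
    simpa using h.symm
  obtain ⟨v, hv, h1, h2⟩ := exists_common_zero_diagonal hd0 (H := U * H * U.transpose) (by
    rw [Matrix.trace_mul_comm, ← Matrix.mul_assoc, mul_eq_one_comm.1 hU1, Matrix.one_mul, hH])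
  have conj : ∀ R : Matrix (Fin 3) (Fin 3) ℝ, v ⬝ᵥ (U * R * U.transpose).mulVec v =
      (U.transpose.mulVec v) ⬝ᵥ R.mulVec (U.transpose.mulVec v) := by
    intro R
    rw [← Matrix.mulVec_mulVec, ← Matrix.mulVec_mulVec, Matrix.dotProduct_mulVec,
      Matrix.mulVec_transpose]
  refine ⟨U.transpose.mulVec v, fun h => hv ?_, ?_, ?_⟩
  · have := congrArg U.mulVec h
    rwa [Matrix.mulVec_mulVec, hU1, Matrix.one_mulVec, Matrix.mulVec_zero] at this
  · have htr : ∀ w : Fin 3 → ℝ, w ⬝ᵥ G.transpose.mulVec w = w ⬝ᵥ G.mulVec w := fun w => by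
      rw [Matrix.mulVec_transpose, dotProduct_comm, ← Matrix.dotProduct_mulVec]
    have h3 := conj (G + G.transpose)
    rw [show U * (G + G.transpose) * U.transpose = Matrix.diagonal d by
      rw [hd, show U * (U.transpose * Matrix.diagonal d * U) * U.transpose =
        (U * U.transpose) * Matrix.diagonal d * (U * U.transpose) by simp only [Matrix.mul_assoc],
        hU1, Matrix.one_mul, Matrix.mul_one], h1, Matrix.add_mulVec, dotProduct_add,
      htr] at h3
    linarith
  · rw [← conj]
    exact h2

/-! ### Complexification of real matrices -/

/-- A real matrix regarded as a complex one. -/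
abbrev Matrix.complexify {m n : Type*} (B : Matrix m n ℝ) : Matrix m n ℂ :=
  B.map fun t : ℝ => (t : ℂ)

/-- A real vector regarded as a complex one. -/
abbrev complexifyVec {n : Type*} (v : n → ℝ) : n → ℂ := fun i => (v i : ℂ)

namespace Matrix

variable {l m n : Type*}

theorem complexify_mul [Fintype m] (A : Matrix l m ℝ) (B : Matrix m n ℝ) :
    (A * B).complexify = A.complexify * B.complexify := by
  ext i j
  simp [mul_apply]

theorem complexify_one [DecidableEq n] : (1 : Matrix n n ℝ).complexify = 1 := by
  ext i j
  by_cases h : i = j <;> simp [one_apply, h]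

theorem complexify_diagonal [DecidableEq n] (d : n → ℝ) :
    (diagonal d).complexify = diagonal fun i => (d i : ℂ) := by
  ext i j
  by_cases h : i = j <;> simp [h]

theorem complexify_mulVec [Fintype n] (A : Matrix m n ℝ) (v : n → ℝ) :
    A.complexify.mulVec (complexifyVec v) = complexifyVec (A.mulVec v) := by
  ext i
  simp [mulVec, dotProduct, complexifyVec]

theorem conjTranspose_complexify (A : Matrix m n ℝ) :
    A.complexify.conjTranspose = A.transpose.complexify := by
  ext i j
  simp

open scoped MatrixOrder in
theorem PosSemidef.complexify [Fintype n] [DecidableEq n] {A : Matrix n n ℝ}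
    (hA : A.PosSemidef) : A.complexify.PosSemidef := by
  obtain ⟨B, rfl⟩ := CStarAlgebra.nonneg_iff_eq_star_mul_self.mp hA.nonneg
  rw [star_eq_conjTranspose, complexify_mul, conjTranspose_eq_transpose_of_trivial, ← conjTranspose_complexify]
  exact posSemidef_conjTranspose_mul_self _

/-! ### Reducing the rank of a PSD matrix -/

theorem PosSemidef.eq_zero_of_diag_eq_zero [Fintype n] [DecidableEq n] {W : Matrix n n ℂ}
    (hW : W.PosSemidef) {a : n} (h : W a a = 0) (b : n) : W b a = 0 := by
  have h1 := (hW.dotProduct_mulVec_zero_iff (Pi.single a 1)).1 (by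
    simp [h])
  simpa using congrFun h1 b

/-- Subtracting a suitable multiple of the projector on a non-zero vector of its range from a
PSD matrix leaves a PSD matrix of smaller rank. -/
theorem PosSemidef.exists_sub_rank_lt [Fintype n] [DecidableEq n] {W : Matrix n n ℂ}
    (hW : W.PosSemidef) {x : n → ℂ} (hx : W.mulVec x ≠ 0) :
    ∃ c : ℝ, 0 < c ∧
      (W - (c : ℂ) • vecMulVec (W.mulVec x) (star (W.mulVec x))).PosSemidef ∧
      (W - (c : ℂ) • vecMulVec (W.mulVec x) (star (W.mulVec x))).rank < W.rank := by
  set w := W.mulVec x with hw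
  set q : ℂ := star x ⬝ᵥ w with hq
  have hq0 : 0 ≤ q := hW.dotProduct_mulVec_nonneg x
  have hqne : q ≠ 0 := fun h => hx ((hW.dotProduct_mulVec_zero_iff x).1 h)
  have hqre : ((q.re : ℝ) : ℂ) = q := (Complex.eq_re_of_ofReal_le (r := 0) (by simpa using hq0)).symm
  have hqpos : 0 < q.re := by
    have := (Complex.nonneg_iff.1 hq0).1
    exact lt_of_le_of_ne this fun h => hqne (by rw [← hqre, ← h]; simp)
  have hsw : star w = vecMul (star x) W := by
    rw [hw, star_mulVec, hW.isHermitian]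
  have hswx : star w ⬝ᵥ x = q := by
    rw [hsw, ← dotProduct_mulVec]
  have hc : (((q.re)⁻¹ : ℝ) : ℂ) = q⁻¹ := by rw [Complex.ofReal_inv, hqre]
  have hstar : star (q⁻¹) = q⁻¹ := by
    rw [← hc]
    exact Complex.conj_ofReal _
  -- With q = x*Wx, the difference W - q⁻¹ww* equals R*WR for R = 1 - q⁻¹xw*, hence is PSD. Its
  -- kernel contains that of W and also x.
  refine ⟨(q.re)⁻¹, inv_pos.2 hqpos, ?_, ?_⟩
  · rw [hc]
    have h := hW.conjTranspose_mul_mul_same (1 - q⁻¹ • vecMulVec x (star w))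
    have e1 : W * vecMulVec x (star w) = vecMulVec w (star w) := by
      rw [mul_vecMulVec]
    have e2 : vecMulVec w (star x) * W = vecMulVec w (star w) := by
      rw [vecMulVec_mul, hsw]
    have e3 : vecMulVec w (star x) * vecMulVec w (star w) = q • vecMulVec w (star w) := by
      rw [vecMulVec_mul_vecMulVec, ← hq, vecMulVec_smul]
    have e4 : (1 - q⁻¹ • vecMulVec x (star w)).conjTranspose = 1 - q⁻¹ • vecMulVec w (star x) := by
      rw [conjTranspose_sub, conjTranspose_one, conjTranspose_smul, conjTranspose_vecMulVec,
        star_star, hstar]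
    rw [e4] at h
    convert h using 1
    rw [Matrix.mul_assoc, Matrix.mul_sub, Matrix.mul_smul, e1, Matrix.mul_one, Matrix.sub_mul,
      Matrix.one_mul, Matrix.mul_sub, Matrix.smul_mul, e2, Matrix.smul_mul, Matrix.mul_smul, e3,
      inv_smul_smul₀ hqne]
    abel
  · rw [hc]
    set W' := W - q⁻¹ • vecMulVec w (star w)
    have hW' : ∀ y, W'.mulVec y = W.mulVec y - (q⁻¹ * (star w ⬝ᵥ y)) • w := by
      intro y
      ext i
      simp [W', sub_mulVec, smul_mulVec, vecMulVec_mulVec]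
      ring
    have hlt : LinearMap.ker W.mulVecLin < LinearMap.ker W'.mulVecLin := by
      refine lt_of_le_of_ne (fun y hy => ?_) fun h => ?_
      · rw [LinearMap.mem_ker, mulVecLin_apply] at hy ⊢
        rw [hW', hy, hsw, ← dotProduct_mulVec, hy]
        simp
      · have hx' : x ∈ LinearMap.ker W'.mulVecLin := by
          rw [LinearMap.mem_ker, mulVecLin_apply, hW', hswx, inv_mul_cancel₀ hqne, one_smul, hw,
            sub_self]
        rw [← h] at hx'
        exact hx hx'
    have h1 := Submodule.finrank_lt_finrank_of_lt hlt
    have h2 := W.mulVecLin.finrank_range_add_finrank_ker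
    have h3 := W'.mulVecLin.finrank_range_add_finrank_ker
    rw [rank, rank]
    omega

end Matrix

/-! ### The separable cone as a set of matrices -/

/-- The cone generated by the matrices `x ⊗ y` with `x` complex PSD and `y` real PSD. -/
def sepCone (m n : ℕ) : AddSubmonoid (Matrix (Fin m × Fin n) (Fin m × Fin n) ℂ) :=
  AddSubmonoid.closure {M | ∃ (x : Matrix (Fin m) (Fin m) ℂ) (y : Matrix (Fin n) (Fin n) ℝ),
    x.PosSemidef ∧ y.PosSemidef ∧ M = x ⊗ₖ y.complexify}

theorem kronecker_mem_sepCone {m n : ℕ} {x : Matrix (Fin m) (Fin m) ℂ}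
    {y : Matrix (Fin n) (Fin n) ℝ} (hx : x.PosSemidef) (hy : y.PosSemidef) :
    x ⊗ₖ y.complexify ∈ sepCone m n :=
  AddSubmonoid.subset_closure ⟨x, y, hx, hy, rfl⟩

/-- The blocks `B` of `W` are transformed into `S B Sᵀ`. -/
def blockCongr {m n : ℕ} (S : Matrix (Fin n) (Fin n) ℝ)
    (W : Matrix (Fin m × Fin n) (Fin m × Fin n) ℂ) :
    Matrix (Fin m × Fin n) (Fin m × Fin n) ℂ :=
  ((1 : Matrix (Fin m) (Fin m) ℂ) ⊗ₖ S.complexify) * W *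
    ((1 : Matrix (Fin m) (Fin m) ℂ) ⊗ₖ S.transpose.complexify)

/-- All blocks of `W` are symmetric. -/
def HasSymmBlocks {m n : ℕ} (W : Matrix (Fin m × Fin n) (Fin m × Fin n) ℂ) : Prop :=
  ∀ α β i j, W (α, i) (β, j) = W (α, j) (β, i)

/-- The product of a complex and a real vector. -/
def tensorVec {m n : ℕ} (z : Fin m → ℂ) (v : Fin n → ℝ) : Fin m × Fin n → ℂ :=
  fun p => z p.1 * (v p.2 : ℂ)

section

variable {m n : ℕ}

theorem ext_matBlock {W W' : Matrix (Fin m × Fin n) (Fin m × Fin n) ℂ}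
    (h : ∀ α β, matBlock W α β = matBlock W' α β) : W = W' := by
  ext ⟨α, i⟩ ⟨β, j⟩
  exact congrFun (congrFun (h α β) i) j

theorem matBlock_blockCongr (S : Matrix (Fin n) (Fin n) ℝ)
    (W : Matrix (Fin m × Fin n) (Fin m × Fin n) ℂ) (α β : Fin m) :
    matBlock (blockCongr S W) α β =
      S.complexify * matBlock W α β * S.transpose.complexify := by
  ext i j
  simp [matBlock, blockCongr, Matrix.mul_apply, Fintype.sum_prod_type, Matrix.one_apply,
    Finset.sum_ite_eq]

theorem blockCongr_blockCongr (S T : Matrix (Fin n) (Fin n) ℝ)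
    (W : Matrix (Fin m × Fin n) (Fin m × Fin n) ℂ) :
    blockCongr S (blockCongr T W) = blockCongr (S * T) W := by
  refine ext_matBlock fun α β => ?_
  simp only [matBlock_blockCongr, Matrix.transpose_mul, Matrix.complexify_mul, Matrix.mul_assoc]

theorem blockCongr_one (W : Matrix (Fin m × Fin n) (Fin m × Fin n) ℂ) :
    blockCongr 1 W = W := by
  refine ext_matBlock fun α β => ?_
  simp only [matBlock_blockCongr, Matrix.transpose_one, Matrix.complexify_one, Matrix.one_mul,
    Matrix.mul_one]

theorem hasSymmBlocks_iff {W : Matrix (Fin m × Fin n) (Fin m × Fin n) ℂ} :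
    HasSymmBlocks W ↔ ∀ α β, (matBlock W α β).transpose = matBlock W α β :=
  ⟨fun h α β => by ext i j; exact h α β j i,
    fun h α β i j => congrFun (congrFun (h α β) j) i⟩

theorem HasSymmBlocks.blockCongr {W : Matrix (Fin m × Fin n) (Fin m × Fin n) ℂ}
    (hW : HasSymmBlocks W) (S : Matrix (Fin n) (Fin n) ℝ) : HasSymmBlocks (blockCongr S W) := by
  rw [hasSymmBlocks_iff] at hW ⊢
  intro α β
  rw [matBlock_blockCongr, Matrix.transpose_mul, Matrix.transpose_mul, hW, Matrix.mul_assoc]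
  rfl

theorem conjTranspose_one_kronecker (S : Matrix (Fin n) (Fin n) ℝ) :
    ((1 : Matrix (Fin m) (Fin m) ℂ) ⊗ₖ S.complexify).conjTranspose =
      (1 : Matrix (Fin m) (Fin m) ℂ) ⊗ₖ S.transpose.complexify := by
  rw [Matrix.conjTranspose_kronecker, Matrix.conjTranspose_one, Matrix.conjTranspose_complexify]

theorem posSemidef_blockCongr {W : Matrix (Fin m × Fin n) (Fin m × Fin n) ℂ}
    (hW : W.PosSemidef) (S : Matrix (Fin n) (Fin n) ℝ) : (blockCongr S W).PosSemidef := by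
  rw [blockCongr, ← conjTranspose_one_kronecker]
  exact hW.mul_mul_conjTranspose_same _

theorem blockCongr_mem_sepCone {W : Matrix (Fin m × Fin n) (Fin m × Fin n) ℂ}
    (hW : W ∈ sepCone m n) (S : Matrix (Fin n) (Fin n) ℝ) : blockCongr S W ∈ sepCone m n := by
  induction hW using AddSubmonoid.closure_induction with
  | mem M hM =>
    obtain ⟨x, y, hx, hy, rfl⟩ := hM
    rw [blockCongr, ← Matrix.mul_kronecker_mul, ← Matrix.mul_kronecker_mul, Matrix.one_mul,
      Matrix.mul_one, ← Matrix.complexify_mul, ← Matrix.complexify_mul]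
    refine kronecker_mem_sepCone hx ?_
    rw [← Matrix.conjTranspose_eq_transpose_of_trivial]
    exact hy.mul_mul_conjTranspose_same _
  | zero => simp [blockCongr]
  | add A B _ _ hA hB =>
    rw [show blockCongr S (A + B) = blockCongr S A + blockCongr S B by
      simp [blockCongr, Matrix.mul_add, Matrix.add_mul]]
    exact add_mem hA hB

theorem one_kronecker_mulVec_tensorVec (S : Matrix (Fin n) (Fin n) ℝ) (z : Fin m → ℂ)
    (v : Fin n → ℝ) :
    ((1 : Matrix (Fin m) (Fin m) ℂ) ⊗ₖ S.complexify).mulVec (tensorVec z v) =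
      tensorVec z (S.mulVec v) := by
  ext ⟨α, i⟩
  simp only [Matrix.mulVec, dotProduct, tensorVec, Fintype.sum_prod_type, Matrix.kronecker_apply,
    Matrix.one_apply, Matrix.map_apply, ite_mul, one_mul, zero_mul, Complex.ofReal_sum,
    Complex.ofReal_mul, Finset.mul_sum]
  rw [Finset.sum_eq_single α]
  · simp only [if_true]
    exact Finset.sum_congr rfl fun j _ => by ring
  · intro β _ h
    simp [h.symm]
  · simp

theorem vecMulVec_tensorVec (z : Fin m → ℂ) (v : Fin n → ℝ) :
    Matrix.vecMulVec (tensorVec z v) (star (tensorVec z v)) =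
      Matrix.vecMulVec z (star z) ⊗ₖ (Matrix.vecMulVec v v).complexify := by
  ext ⟨α, i⟩ ⟨β, j⟩
  simp [Matrix.vecMulVec_apply, tensorVec]
  ring

theorem smul_vecMulVec_tensorVec_mem_sepCone {c : ℝ} (hc : 0 ≤ c) (z : Fin m → ℂ)
    (v : Fin n → ℝ) :
    (c : ℂ) • Matrix.vecMulVec (tensorVec z v) (star (tensorVec z v)) ∈ sepCone m n := by
  rw [vecMulVec_tensorVec, ← Matrix.smul_kronecker]
  refine kronecker_mem_sepCone ((Matrix.posSemidef_vecMulVec_self_star z).smul ?_) ?_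
  · simpa using hc
  · simpa using Matrix.posSemidef_vecMulVec_self_star v

/-- If the range of every non-separable PSD matrix with symmetric blocks contains a product vector
with real second factor, then all PSD matrices with symmetric blocks are separable. -/
theorem mem_sepCone_of_exists_tensorVec
    (h : ∀ W : Matrix (Fin m × Fin n) (Fin m × Fin n) ℂ, W.PosSemidef → HasSymmBlocks W →
      W ∈ sepCone m n ∨ ∃ x z v, W.mulVec x = tensorVec z v ∧ W.mulVec x ≠ 0)
    {W : Matrix (Fin m × Fin n) (Fin m × Fin n) ℂ} (hW : W.PosSemidef) (hs : HasSymmBlocks W) :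
    W ∈ sepCone m n := by
  induction hr : W.rank using Nat.strong_induction_on generalizing W with
  | _ r ih =>
    subst hr
    rcases h W hW hs with h | ⟨x, z, v, hx, h0⟩
    · exact h
    obtain ⟨c, hc, h1, h2⟩ := hW.exists_sub_rank_lt h0
    rw [hx] at h1 h2
    -- Realness of v enters here: v vᵀ is symmetric, so the difference still has symmetric blocks.
    have h3 := ih _ h2 h1 (by
      intro α β i j
      rw [vecMulVec_tensorVec]
      simp only [Matrix.sub_apply, Matrix.smul_apply, Matrix.kronecker_apply, Matrix.map_apply,
        Matrix.vecMulVec_apply, hs α β i j, mul_comm (v i)]) rfl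
    have h4 := add_mem h3 (smul_vecMulVec_tensorVec_mem_sepCone hc.le z v)
    rwa [sub_add_cancel] at h4

end

/-! ### PSD matrices with four symmetric blocks of size three -/

/-- The vector with the two given blocks. -/
def pairVec {n : ℕ} (u x : Fin n → ℂ) : Fin 2 × Fin n → ℂ := fun p => ![u, x] p.1 p.2

section

variable {n : ℕ}

theorem mulVec_pairVec (W : Matrix (Fin 2 × Fin n) (Fin 2 × Fin n) ℂ) (u x : Fin n → ℂ) :
    W.mulVec (pairVec u x) =
      pairVec ((matBlock W 0 0).mulVec u + (matBlock W 0 1).mulVec x)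
        ((matBlock W 1 0).mulVec u + (matBlock W 1 1).mulVec x) := by
  ext ⟨α, i⟩
  fin_cases α <;>
    simp [Matrix.mulVec, dotProduct, pairVec, matBlock, Fintype.sum_prod_type]

theorem tensorVec_eq_pairVec (a b : ℂ) (v : Fin n → ℝ) :
    tensorVec ![a, b] v = pairVec (a • complexifyVec v) (b • complexifyVec v) := by
  ext ⟨α, i⟩
  fin_cases α <;> simp [tensorVec, pairVec]

/-- The blocks of a hermitian matrix with symmetric blocks. -/
theorem exists_blocks {W : Matrix (Fin 2 × Fin n) (Fin 2 × Fin n) ℂ} (hW : W.IsHermitian)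
    (hs : HasSymmBlocks W) :
    ∃ (A P Q D : Matrix (Fin n) (Fin n) ℝ), A.IsSymm ∧ P.IsSymm ∧ Q.IsSymm ∧ D.IsSymm ∧
      matBlock W 0 0 = A.complexify ∧
      matBlock W 0 1 = P.complexify + Complex.I • Q.complexify ∧
      matBlock W 1 0 = P.complexify - Complex.I • Q.complexify ∧
      matBlock W 1 1 = D.complexify := by
  -- Hermiticity and blockwise symmetry together make opposite blocks entrywise conjugate; in
  -- particular the diagonal blocks are real.
  have hh : ∀ α β i j, W (α, i) (β, j) = star (W (β, i) (α, j)) := fun α β i j => by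
    rw [hs β α i j]
    exact (hW.apply _ _).symm
  have hre : ∀ α i j, (((W (α, i) (α, j)).re : ℝ) : ℂ) = W (α, i) (α, j) := fun α i j =>
    Complex.conj_eq_iff_re.1 (hh α α i j).symm
  refine ⟨Matrix.of fun i j => (W (0, i) (0, j)).re, Matrix.of fun i j => (W (0, i) (1, j)).re,
    Matrix.of fun i j => (W (0, i) (1, j)).im, Matrix.of fun i j => (W (1, i) (1, j)).re,
    ?_, ?_, ?_, ?_, ?_, ?_, ?_, ?_⟩
  · ext i j; simp [hs 0 0 i j]
  · ext i j; simp [hs 0 1 i j]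
  · ext i j; simp [hs 0 1 i j]
  · ext i j; simp [hs 1 1 i j]
  · ext i j; simp [matBlock, hre]
  · ext i j
    simp [matBlock, mul_comm Complex.I, Complex.re_add_im]
  · ext i j
    simp only [matBlock, Matrix.of_apply, hh 1 0 i j]
    apply Complex.ext <;> simp
  · ext i j; simp [matBlock, hre]

/-- If `(P - iQ)(P + iQ)` is real, then `P` and `Q` commute. -/
theorem commute_of_mul_eq_complexify {P Q D : Matrix (Fin n) (Fin n) ℝ}
    (h : D.complexify = (P.complexify - Complex.I • Q.complexify) *
      (P.complexify + Complex.I • Q.complexify)) :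
    Commute P Q := by
  -- The imaginary part of the product is the commutator of P and Q.
  have h1 : D.complexify = (P * P + Q * Q).complexify + Complex.I • (P * Q - Q * P).complexify := by
    rw [h, show (P * P + Q * Q).complexify = (P * P).complexify + (Q * Q).complexify by
      ext i j; simp, show (P * Q - Q * P).complexify = (P * Q).complexify - (Q * P).complexify by
      ext i j; simp]
    simp only [Matrix.complexify_mul, Matrix.sub_mul, Matrix.mul_add, Matrix.smul_mul,
      Matrix.mul_smul, smul_sub, smul_smul, Complex.I_mul_I, neg_smul, one_smul]
    abel
  rw [commute_iff_eq, ← sub_eq_zero]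
  ext i j
  have := congrArg Complex.im (congrFun (congrFun h1 i) j)
  simpa using this.symm

theorem complexify_diagonalized {U : Matrix (Fin n) (Fin n) ℝ} (p q : Fin n → ℝ) (s : ℂ) :
    (U.transpose * Matrix.diagonal p * U).complexify +
      s • (U.transpose * Matrix.diagonal q * U).complexify =
    U.transpose.complexify * Matrix.diagonal (fun i => (p i : ℂ) + s * q i) * U.complexify := by
  simp only [Matrix.complexify_mul, Matrix.complexify_diagonal]
  rw [← Matrix.smul_mul, ← Matrix.mul_smul, ← Matrix.add_mul, ← Matrix.mul_add]
  congr 2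
  ext i j
  by_cases h : i = j <;> simp [h]

/-- If the blocks of `W` are `E B Eᵀ`, where `B` runs over the blocks of `[[1, C], [C*, C* C]]` and
`C = P + iQ` with commuting real symmetric `P` and `Q`, then `W` is separable. -/
theorem mem_sepCone_of_commute {W : Matrix (Fin 2 × Fin n) (Fin 2 × Fin n) ℂ}
    {E P Q : Matrix (Fin n) (Fin n) ℝ} (hP : P.IsSymm) (hQ : Q.IsSymm) (hPQ : Commute P Q)
    (h00 : matBlock W 0 0 = (E * E.transpose).complexify)
    (h01 : matBlock W 0 1 = E.complexify * (P.complexify + Complex.I • Q.complexify) *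
      E.transpose.complexify)
    (h10 : matBlock W 1 0 = E.complexify * (P.complexify - Complex.I • Q.complexify) *
      E.transpose.complexify)
    (h11 : matBlock W 1 1 = E.complexify * ((P.complexify - Complex.I • Q.complexify) *
      (P.complexify + Complex.I • Q.complexify)) * E.transpose.complexify) :
    W ∈ sepCone 2 n := by
  obtain ⟨U, hU, p, q, rfl, rfl⟩ := exists_orthogonal_diagonalizing_pair hP hQ hPQ
  have hU1 : U * U.transpose = 1 := (Matrix.mem_orthogonalGroup_iff _ _).1 hU
  have hU2 : U.transpose * U = 1 := mul_eq_one_comm.1 hU1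
  have hU3 : U.complexify * U.transpose.complexify = 1 := by
    rw [← Matrix.complexify_mul, hU1, Matrix.complexify_one]
  have hU4 : U.transpose.complexify * U.complexify = 1 := by
    rw [← Matrix.complexify_mul, hU2, Matrix.complexify_one]
  rw [sub_eq_add_neg, ← neg_smul, complexify_diagonalized] at h10 h11
  rw [complexify_diagonalized] at h01 h11
  -- The second entry is the conjugate of the eigenvalue p + iq of C, so that z z* has p + iq in its
  -- upper right corner.
  let z : Fin n → Fin 2 → ℂ := fun i => ![1, (p i : ℂ) + -Complex.I * q i]
  let X : Matrix (Fin 2 × Fin n) (Fin 2 × Fin n) ℂ :=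
    ∑ i, Matrix.vecMulVec (z i) (star (z i)) ⊗ₖ (Matrix.diagonal (Pi.single i 1)).complexify
  have hX : X ∈ sepCone 2 n := sum_mem fun i _ => kronecker_mem_sepCone
    (Matrix.posSemidef_vecMulVec_self_star _) (Matrix.PosSemidef.diagonal (by simp))
  have hXb : ∀ α β, matBlock X α β = Matrix.diagonal fun i => z i α * star (z i β) := by
    intro α β
    ext i j
    simp only [matBlock, X, Matrix.of_apply, Matrix.sum_apply, Matrix.kronecker_apply,
      Matrix.map_apply, Matrix.vecMulVec_apply, Matrix.diagonal_apply, Pi.star_apply]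
    by_cases h : i = j
    · subst h
      rw [Finset.sum_eq_single i] <;> simp +contextual [eq_comm]
    · simp [h]
  have hWX : W = blockCongr E (blockCongr U.transpose X) := by
    refine ext_matBlock fun α β => ?_
    rw [matBlock_blockCongr, matBlock_blockCongr, hXb, Matrix.transpose_transpose]
    fin_cases α <;> fin_cases β
    · simp only [Fin.zero_eta, h00, z]
      simp [hU4, Matrix.complexify_mul]
    · simp only [Fin.zero_eta, Fin.mk_one, h01, z]
      simp
    · simp only [Fin.zero_eta, Fin.mk_one, h10, z]
      simp
    · simp only [Fin.mk_one, h11, z]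
      rw [show ∀ d d' : Fin n → ℂ, U.transpose.complexify * Matrix.diagonal d * U.complexify *
        (U.transpose.complexify * Matrix.diagonal d' * U.complexify) =
        U.transpose.complexify * Matrix.diagonal d * (U.complexify *
        U.transpose.complexify) * Matrix.diagonal d' * U.complexify by
          intro d d'; simp only [Matrix.mul_assoc], hU3, Matrix.mul_one, Matrix.mul_assoc _
          (Matrix.diagonal _) (Matrix.diagonal _), Matrix.diagonal_mul_diagonal]
      simp
  rw [hWX]
  exact blockCongr_mem_sepCone (blockCongr_mem_sepCone hX _) _

end

/-! ### Product vectors in the range, for blocks of size three -/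

/-- For complex symmetric `K` and any `h` there is a real `v ≠ 0` such that `v`, `K v`, `h` are
linearly dependent. -/
theorem exists_real_det_eq_zero {K : Matrix (Fin 3) (Fin 3) ℂ} (hK : K.IsSymm)
    (h : Fin 3 → ℂ) :
    ∃ v : Fin 3 → ℝ, v ≠ 0 ∧
      (Matrix.of ![complexifyVec v, K.mulVec (complexifyVec v), h]).det = 0 := by
  -- The determinant is v · (Kv × h) = v · Nv; in the trace of N the entries of K cancel in
  -- symmetric pairs.
  let N : Matrix (Fin 3) (Fin 3) ℂ :=
    Matrix.of ![h 2 • K 1 - h 1 • K 2, h 0 • K 2 - h 2 • K 0, h 1 • K 0 - h 0 • K 1]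
  have htr : N.trace = 0 := by
    have h1 := hK.apply 0 1
    have h2 := hK.apply 0 2
    have h3 := hK.apply 1 2
    simp [N, Matrix.trace_fin_three, h1, h2, h3]
  have hN : N = (N.map Complex.re).complexify + Complex.I • (N.map Complex.im).complexify := by
    ext i j
    simp [mul_comm Complex.I, Complex.re_add_im]
  obtain ⟨v, hv, h1, h2⟩ := exists_common_zero_of_trace_eq_zero (G := N.map Complex.re)
    (H := N.map Complex.im)
    (by simpa [Matrix.trace_fin_three] using congrArg Complex.re htr)
    (by simpa [Matrix.trace_fin_three] using congrArg Complex.im htr)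
  have hdot : ∀ x : Fin 3 → ℝ, complexifyVec v ⬝ᵥ complexifyVec x = ((v ⬝ᵥ x : ℝ) : ℂ) := by
    intro x
    simp [dotProduct, complexifyVec]
  refine ⟨v, hv, ?_⟩
  have h3 : complexifyVec v ⬝ᵥ N.mulVec (complexifyVec v) = 0 := by
    rw [hN, Matrix.add_mulVec, Matrix.smul_mulVec, Matrix.complexify_mulVec,
      Matrix.complexify_mulVec, dotProduct_add, dotProduct_smul, hdot, hdot, h1, h2]
    simp
  rw [← h3, Matrix.det_fin_three]
  simp [N, Matrix.mulVec, dotProduct, Fin.sum_univ_three]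
  ring

/-- The case of a diagonal upper left block with entries `0` and `1`. -/
theorem mem_sepCone_or_exists_tensorVec_of_diagonal
    {W : Matrix (Fin 2 × Fin 3) (Fin 2 × Fin 3) ℂ} (hW : W.PosSemidef) (hs : HasSymmBlocks W)
    {e : Fin 3 → ℝ} (he : ∀ i, e i = 0 ∨ e i = 1)
    (hA : matBlock W 0 0 = (Matrix.diagonal e).complexify) :
    W ∈ sepCone 2 3 ∨ ∃ x z v, W.mulVec x = tensorVec z v ∧ W.mulVec x ≠ 0 := by
  obtain ⟨-, P, Q, D, -, hP, hQ, hD, -, h01, h10, h11⟩ := exists_blocks hW.isHermitian hs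
  set C := P.complexify + Complex.I • Q.complexify with hC
  set C' := P.complexify - Complex.I • Q.complexify with hC'
  have hCs : C.IsSymm := by rw [← h01]; exact hasSymmBlocks_iff.1 hs 0 1
  have hCs' : C'.IsSymm := by rw [← h10]; exact hasSymmBlocks_iff.1 hs 1 0
  clear_value C C'
  -- If `e i = 0`, positivity and block symmetry kill the upper half of column (1, i). A nonzero
  -- column of D there gives the product vector (0, 1) ⊗ D e_i; otherwise every block is supported
  -- where `e` is 1.
  by_cases hdone : ∃ i, e i = 0 ∧ ∃ j, D j i ≠ 0
  · obtain ⟨i, hi, j, hj⟩ := hdone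
    right
    have h0 : ∀ j, W (0, j) (1, i) = 0 := fun j => by
      have h1 : W (0, i) (0, i) = 0 := by
        have := congrFun (congrFun hA i) i
        simpa [matBlock, hi] using this
      have h2 := hW.eq_zero_of_diag_eq_zero h1 (1, j)
      rw [hs 0 1 j i, ← hW.isHermitian.apply, h2, star_zero]
    have h1 : ∀ j, W (1, j) (1, i) = D j i := fun j => congrFun (congrFun h11 j) i
    have hWx : W.mulVec (Pi.single (1, i) 1) = tensorVec ![0, 1] fun j => D j i := by
      ext ⟨α, k⟩
      fin_cases α
      · simpa [tensorVec] using h0 k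
      · simpa [tensorVec] using h1 k
    refine ⟨_, _, _, hWx, fun h => hj ?_⟩
    rw [hWx] at h
    simpa [tensorVec] using congrFun h (1, j)
  push Not at hdone
  have hC0 : ∀ i, e i = 0 → ∀ j, C' j i = 0 ∧ C j i = 0 := by
    intro i hi j
    have h1 : W (0, i) (0, i) = 0 := by
      have := congrFun (congrFun hA i) i
      simpa [matBlock, hi] using this
    have h2 := hW.eq_zero_of_diag_eq_zero h1 (1, j)
    refine ⟨by rw [← h10]; exact h2, ?_⟩
    rw [← h01]
    change W (0, j) (1, i) = 0
    rw [hs 0 1 j i, ← hW.isHermitian.apply, h2, star_zero]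
  have hEC : (Matrix.diagonal e).complexify * C = C := by
    rw [Matrix.complexify_diagonal]
    ext i j
    rw [Matrix.diagonal_mul]
    rcases he i with h | h
    · rw [← hCs.apply i j, (hC0 i h j).2, mul_zero]
    · simp [h]
  have hmulE : ∀ B : Matrix (Fin 3) (Fin 3) ℂ, (∀ i, e i = 0 → ∀ j, B j i = 0) →
      B * (Matrix.diagonal e).complexify = B := by
    intro B hB
    rw [Matrix.complexify_diagonal]
    ext i j
    rw [Matrix.mul_diagonal]
    rcases he j with h | h
    · rw [hB j h i, zero_mul]
    · simp [h]
  have hEC' : (Matrix.diagonal e).complexify * C' = C' := by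
    rw [Matrix.complexify_diagonal]
    ext i j
    rw [Matrix.diagonal_mul]
    rcases he i with h | h
    · rw [← hCs'.apply i j, (hC0 i h j).1, mul_zero]
    · simp [h]
  have hCE := hmulE C fun i hi j => (hC0 i hi j).2
  have hCE' := hmulE C' fun i hi j => (hC0 i hi j).1
  by_cases hM : D.complexify = C' * C
  · left
    refine mem_sepCone_of_commute (E := Matrix.diagonal e) hP hQ
      (commute_of_mul_eq_complexify (by rw [hM, hC, hC'])) ?_ ?_ ?_ ?_
    · rw [hA, Matrix.diagonal_transpose, Matrix.diagonal_mul_diagonal]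
      congr 2
      funext i
      rcases he i with h | h <;> simp [h]
    · rw [h01, Matrix.diagonal_transpose, ← hC, hEC, hCE]
    · rw [h10, Matrix.diagonal_transpose, ← hC', hEC', hCE']
    · rw [h11, hM, Matrix.diagonal_transpose, ← hC, ← hC', Matrix.mul_assoc, Matrix.mul_assoc C',
        hCE, ← Matrix.mul_assoc, hEC']
  right
  obtain ⟨x, hx⟩ : ∃ x, (D.complexify - C' * C).mulVec x ≠ 0 := by
    by_contra! h
    refine hM (sub_eq_zero.1 (Matrix.ext_of_mulVec_single fun i => ?_))
    rw [h, Matrix.zero_mulVec]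
  set h := (D.complexify - C' * C).mulVec x with hh
  have hh0 : ∀ i, e i = 0 → h i = 0 := by
    intro i hi
    rw [hh, Matrix.mulVec, dotProduct]
    refine Finset.sum_eq_zero fun j _ => ?_
    have h1 : D.complexify i j = 0 := by
      have h0 : D i j = 0 := by rw [← hD.apply i j, hdone i hi j]
      simp [h0]
    have h2 : (C' * C) i j = 0 := by
      rw [Matrix.mul_apply]
      exact Finset.sum_eq_zero fun k _ => by rw [← hCs'.apply i k, (hC0 i hi k).1, zero_mul]
    rw [Matrix.sub_apply, h1, h2, sub_zero, zero_mul]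
  obtain ⟨v, hv, hve, hdet⟩ : ∃ v : Fin 3 → ℝ, v ≠ 0 ∧ (∀ i, e i = 0 → v i = 0) ∧
      (Matrix.of ![complexifyVec v, C'.mulVec (complexifyVec v), h]).det = 0 := by
    -- If some `e i` vanishes, all three rows have zero i-th coordinate, so the determinant vanishes
    -- for any v supported where `e` is 1. Only e = (1, 1, 1) needs the common zero of quadratic
    -- forms.
    by_cases hall : ∀ i, e i ≠ 0
    · obtain ⟨v, hv, hdet⟩ := exists_real_det_eq_zero hCs' h
      exact ⟨v, hv, fun i hi => absurd hi (hall i), hdet⟩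
    · push Not at hall
      obtain ⟨i, hi⟩ := hall
      obtain ⟨j, hj⟩ := Function.ne_iff.1 hx
      have hej : e j ≠ 0 := fun h => hj (hh0 j h)
      have hv : ∀ k, e k = 0 → (Pi.single j 1 : Fin 3 → ℝ) k = 0 := fun k hk =>
        Pi.single_eq_of_ne (fun hkj => hej (by rw [← hkj, hk])) _
      refine ⟨Pi.single j 1, by simp, hv, Matrix.det_eq_zero_of_column_eq_zero i fun a => ?_⟩
      fin_cases a
      · simp [complexifyVec, hv i hi]
      · simp only [Matrix.of_apply, Fin.mk_one, Matrix.cons_val_one, Matrix.cons_val_zero,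
          Matrix.mulVec, dotProduct]
        refine Finset.sum_eq_zero fun k _ => ?_
        rw [← hCs'.apply i k, (hC0 i hi k).1, zero_mul]
      · simpa using hh0 i hi
  obtain ⟨g, hg, hg0⟩ := Matrix.exists_vecMul_eq_zero_iff.2 hdet
  have hdep : g 0 • complexifyVec v + g 1 • C'.mulVec (complexifyVec v) + g 2 • h = 0 := by
    funext i
    have := congrFun hg0 i
    simpa [Matrix.vecMul, dotProduct, Fin.sum_univ_three] using this
  have hvne : complexifyVec v ≠ 0 := fun h0 => hv (by
    funext i
    simpa [complexifyVec] using congrFun h0 i)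
  have hEv : (Matrix.diagonal e).complexify.mulVec (complexifyVec v) = complexifyVec v := by
    rw [Matrix.complexify_mulVec]
    congr 1
    funext i
    rw [Matrix.mulVec_diagonal]
    rcases he i with h | h
    · rw [hve i h, mul_zero]
    · rw [h, one_mul]
  -- The preimage is chosen so that C x cancels in the upper half, leaving the Schur complement
  -- applied to x below.
  have hWx : ∀ (s t : ℂ), W.mulVec (pairVec (t • complexifyVec v - s • C.mulVec x) (s • x)) =
      pairVec (t • complexifyVec v) (t • C'.mulVec (complexifyVec v) + s • h) := by
    intro s t
    rw [mulVec_pairVec, hA, h01, h10, h11, Matrix.mulVec_sub, Matrix.mulVec_smul,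
      Matrix.mulVec_smul, Matrix.mulVec_mulVec, hEC, hEv, Matrix.mulVec_smul, Matrix.mulVec_sub,
      Matrix.mulVec_smul, Matrix.mulVec_smul, Matrix.mulVec_mulVec, Matrix.mulVec_smul, hh,
      Matrix.sub_mulVec, smul_sub, sub_add_cancel]
    congr 1
    abel
  -- If `g 1 = 0` then h is itself a multiple of v, and t = 0 yields a vector with zero upper half,
  -- nonzero because h is. Otherwise t = `g 1` makes the upper half nonzero.
  by_cases h1 : g 1 = 0
  · have h2 : g 2 ≠ 0 := fun h2 => by
      have h3 : g 0 ≠ 0 := fun h3 => hg (by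
        funext i
        fin_cases i
        exacts [h3, h1, h2])
      rw [h1, h2, zero_smul, zero_smul, add_zero, add_zero] at hdep
      exact (smul_ne_zero h3 hvne) hdep
    have hW1 := hWx (g 2) 0
    have h4 : g 2 • h = (-g 0) • complexifyVec v := by
      rw [h1, zero_smul, add_zero, add_comm] at hdep
      rw [neg_smul, eq_neg_of_add_eq_zero_left hdep]
    rw [zero_smul, zero_smul, zero_add, h4, ← zero_smul ℂ (complexifyVec v),
      ← tensorVec_eq_pairVec] at hW1
    refine ⟨_, _, _, hW1, fun h0 => ?_⟩
    rw [hW1, tensorVec_eq_pairVec, ← h4] at h0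
    exact (smul_ne_zero h2 hx) (funext fun i => by simpa [pairVec] using congrFun h0 (1, i))
  · have hW1 := hWx (g 2) (g 1)
    have h4 : g 1 • C'.mulVec (complexifyVec v) + g 2 • h = (-g 0) • complexifyVec v := by
      rw [neg_smul]
      rw [add_assoc, add_comm] at hdep
      exact eq_neg_of_add_eq_zero_left hdep
    rw [h4, ← tensorVec_eq_pairVec] at hW1
    refine ⟨_, _, _, hW1, fun h0 => ?_⟩
    rw [hW1, tensorVec_eq_pairVec] at h0
    exact (smul_ne_zero h1 hvne) (funext fun i => by simpa [pairVec] using congrFun h0 (0, i))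

/-- An invertible real congruence reduces to the diagonal case. It acts on the second tensor factor
only, so it carries product vectors with real second factor to such vectors and preserves
separability. -/
theorem mem_sepCone_or_exists_tensorVec
    {W : Matrix (Fin 2 × Fin 3) (Fin 2 × Fin 3) ℂ} (hW : W.PosSemidef) (hs : HasSymmBlocks W) :
    W ∈ sepCone 2 3 ∨ ∃ x z v, W.mulVec x = tensorVec z v ∧ W.mulVec x ≠ 0 := by
  obtain ⟨A, -, -, -, -, -, -, -, hA, -, -, -⟩ := exists_blocks hW.isHermitian hs
  have hApsd : A.PosSemidef := by
    refine Matrix.PosSemidef.of_dotProduct_mulVec_nonneg ?_ fun v => ?_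
    · ext i j
      have h1 := congrFun (congrFun hA i) j
      have h2 := congrFun (congrFun hA j) i
      have h3 := hs 0 0 i j
      simp only [matBlock, Matrix.of_apply, Matrix.map_apply] at h1 h2
      rw [h1, h2, Complex.ofReal_inj] at h3
      simpa using h3.symm
    · have h1 := hW.dotProduct_mulVec_nonneg (pairVec (complexifyVec v) 0)
      rw [mulVec_pairVec, hA, Matrix.complexify_mulVec] at h1
      have h2 : star (pairVec (complexifyVec v) 0) ⬝ᵥ pairVec (complexifyVec (A.mulVec v) +
          (matBlock W 0 1).mulVec 0) ((matBlock W 1 0).mulVec (complexifyVec v) +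
          (matBlock W 1 1).mulVec 0) = ((star v ⬝ᵥ A.mulVec v : ℝ) : ℂ) := by
        simp [dotProduct, pairVec, complexifyVec, Fintype.sum_prod_type]
      rw [h2] at h1
      exact_mod_cast h1
  obtain ⟨S, T, e, hST, he, hSA⟩ := exists_congr_diagonal_zero_one hApsd
  have hTS : T * S = 1 := mul_eq_one_comm.1 hST
  rcases mem_sepCone_or_exists_tensorVec_of_diagonal (posSemidef_blockCongr hW S)
    (hs.blockCongr S) he (by
      rw [matBlock_blockCongr, hA, ← Matrix.complexify_mul, ← Matrix.complexify_mul, hSA])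
    with h | ⟨x, z, v, hx, h0⟩
  · left
    have := blockCongr_mem_sepCone h T
    rwa [blockCongr_blockCongr, hTS, blockCongr_one] at this
  · right
    have h1 : W.mulVec (((1 : Matrix (Fin 2) (Fin 2) ℂ) ⊗ₖ S.transpose.complexify).mulVec x) =
        ((1 : Matrix (Fin 2) (Fin 2) ℂ) ⊗ₖ T.complexify).mulVec ((blockCongr S W).mulVec x) := by
      rw [blockCongr, ← Matrix.mulVec_mulVec, ← Matrix.mulVec_mulVec, Matrix.mulVec_mulVec _ _
        (_ ⊗ₖ S.complexify), ← Matrix.mul_kronecker_mul, ← Matrix.complexify_mul, hTS,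
        Matrix.complexify_one, Matrix.one_mul, Matrix.one_kronecker_one, Matrix.one_mulVec]
    refine ⟨((1 : Matrix (Fin 2) (Fin 2) ℂ) ⊗ₖ S.transpose.complexify).mulVec x, z, T.mulVec v, ?_,
      fun h2 => h0 ?_⟩
    · rw [h1, hx, one_kronecker_mulVec_tensorVec]
    · rw [h1] at h2
      have h3 := congrArg
        ((1 : Matrix (Fin 2) (Fin 2) ℂ) ⊗ₖ S.complexify).mulVec h2
      rwa [Matrix.mulVec_mulVec, ← Matrix.mul_kronecker_mul, ← Matrix.complexify_mul, hST,
        Matrix.complexify_one, Matrix.one_mul, Matrix.one_kronecker_one, Matrix.one_mulVec,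
        Matrix.mulVec_zero] at h3

/-- A PSD matrix with four symmetric blocks of size three is separable. -/
theorem mem_sepCone_of_posSemidef {W : Matrix (Fin 2 × Fin 3) (Fin 2 × Fin 3) ℂ}
    (hW : W.PosSemidef) (hs : HasSymmBlocks W) : W ∈ sepCone 2 3 :=
  mem_sepCone_of_exists_tensorVec (fun _ h h' => mem_sepCone_or_exists_tensorVec h h') hW hs

/-! ### The Kronecker representation -/

section

variable {m n : ℕ}

theorem kronRep_tmul (A : HermSpace m) (B : SymSpace n) :
    kronRep m n (A ⊗ₜ[ℝ] B) =
      (A : Matrix (Fin m) (Fin m) ℂ) ⊗ₖ (B : Matrix (Fin n) (Fin n) ℝ).complexify := rfl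

theorem SymSpace.isSymm (B : SymSpace n) : (B : Matrix (Fin n) (Fin n) ℝ).IsSymm := by
  have h : star (B : Matrix (Fin n) (Fin n) ℝ) = B := B.2
  rwa [Matrix.star_eq_conjTranspose, Matrix.conjTranspose_eq_transpose_of_trivial] at h

theorem hasSymmBlocks_kronRep (w : HermSpace m ⊗[ℝ] SymSpace n) :
    HasSymmBlocks (kronRep m n w) := by
  intro α β i j
  induction w using TensorProduct.induction_on with
  | zero => simp
  | tmul A B =>
    have h := (SymSpace.isSymm B).apply i j
    simp [kronRep_tmul, h]
  | add a b ha hb => simp [ha, hb]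

/-- This lifts matrix identities back to tensors. Over ℝ, tensoring the two subspace inclusions
stays injective, and the Kronecker product identifies the full tensor product with the mn × mn
complex matrices. -/
theorem kronRep_injective : Function.Injective (kronRep m n) := by
  have h1 : Function.Injective (TensorProduct.map (HermSpace m).subtype (SymSpace n).subtype) :=
    TensorProduct.map_injective_of_flat_flat _ _ (Submodule.injective_subtype _)
      (Submodule.injective_subtype _)
  let e := (kroneckerTMulLinearEquiv (Fin m) (Fin m) (Fin n) (Fin n) ℝ ℝ ℂ ℝ).trans
    (TensorProduct.rid ℝ ℂ).mapMatrix
  have h2 : ∀ w, kronRep m n w = e (TensorProduct.map (HermSpace m).subtype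
      (SymSpace n).subtype w) := by
    intro w
    induction w using TensorProduct.induction_on with
    | zero => rw [map_zero, map_zero]; exact e.map_zero.symm
    | tmul A B =>
      ext ⟨α, i⟩ ⟨β, j⟩
      simp [e, kronRep_tmul, mul_comm]
    | add a b ha hb => rw [map_add, map_add, ha, hb]; exact (e.map_add _ _).symm
  intro a b hab
  rw [h2, h2] at hab
  exact h1 (e.injective hab)

theorem partialTranspose_kronRep (w : HermSpace m ⊗[ℝ] SymSpace n) :
    partialTranspose (kronRep m n w) = (kronRep m n w).transpose := by
  ext p q
  exact hasSymmBlocks_kronRep w q.1 p.1 p.2 q.2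

theorem isPPT_kronRep_iff (w : HermSpace m ⊗[ℝ] SymSpace n) :
    IsPPT (kronRep m n w) ↔ (kronRep m n w).PosSemidef := by
  rw [IsPPT, partialTranspose_kronRep]
  exact ⟨And.left, fun h => ⟨h, h.transpose⟩⟩

theorem posSemidef_kronRep_of_isSeparableTensor {w : HermSpace m ⊗[ℝ] SymSpace n}
    (hw : IsSeparableTensor (hermPSD m) (symPSD n) w) : (kronRep m n w).PosSemidef := by
  obtain ⟨N, p, x, x', hp, hx, hx', rfl⟩ := hw
  rw [map_sum]
  refine Matrix.posSemidef_sum _ fun l _ => ?_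
  rw [map_smul, kronRep_tmul]
  exact ((hx l).kronecker (hx' l).complexify).smul (hp l).le

theorem IsSeparableTensor.add {E E' : Type*} [AddCommGroup E] [Module ℝ E]
    [AddCommGroup E'] [Module ℝ E'] {K : Set E} {K' : Set E'} {w w' : E ⊗[ℝ] E'}
    (hw : IsSeparableTensor K K' w) (hw' : IsSeparableTensor K K' w') :
    IsSeparableTensor K K' (w + w') := by
  obtain ⟨N, p, x, y, hp, hx, hy, rfl⟩ := hw
  obtain ⟨N', p', x', y', hp', hx', hy', rfl⟩ := hw'
  refine ⟨N + N', Fin.append p p', Fin.append x x', Fin.append y y', ?_, ?_, ?_, ?_⟩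
  · intro l
    induction l using Fin.addCases <;> simp [hp, hp']
  · intro l
    induction l using Fin.addCases <;> simp [hx, hx']
  · intro l
    induction l using Fin.addCases <;> simp [hy, hy']
  · simp [Fin.sum_univ_add]

theorem exists_isSeparableTensor_of_mem_sepCone
    {M : Matrix (Fin m × Fin n) (Fin m × Fin n) ℂ} (hM : M ∈ sepCone m n) :
    ∃ w, IsSeparableTensor (hermPSD m) (symPSD n) w ∧ kronRep m n w = M := by
  induction hM using AddSubmonoid.closure_induction with
  | mem M hM =>
    obtain ⟨x, y, hx, hy, rfl⟩ := hM
    exact ⟨(⟨x, hx.isHermitian⟩ : HermSpace m) ⊗ₜ[ℝ] (⟨y, hy.isHermitian⟩ : SymSpace n),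
      ⟨1, fun _ => 1, fun _ => ⟨x, hx.isHermitian⟩, fun _ => ⟨y, hy.isHermitian⟩,
        fun _ => one_pos, fun _ => hx, fun _ => hy, by simp⟩, rfl⟩
  | zero =>
    exact ⟨0, ⟨0, Fin.elim0, Fin.elim0, Fin.elim0, fun l => l.elim0, fun l => l.elim0,
      fun l => l.elim0, by simp⟩, map_zero _⟩
  | add A B _ _ hA hB =>
    obtain ⟨a, ha, rfl⟩ := hA
    obtain ⟨b, hb, rfl⟩ := hB
    exact ⟨a + b, ha.add hb, map_add _ _ _⟩

theorem isSeparableTensor_iff_posSemidef (w : HermSpace 2 ⊗[ℝ] SymSpace 3) :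
    IsSeparableTensor (hermPSD 2) (symPSD 3) w ↔ (kronRep 2 3 w).PosSemidef := by
  refine ⟨posSemidef_kronRep_of_isSeparableTensor, fun h => ?_⟩
  obtain ⟨w', hw', he⟩ := exists_isSeparableTensor_of_mem_sepCone
    (mem_sepCone_of_posSemidef h (hasSymmBlocks_kronRep w))
  rwa [← kronRep_injective he]

/-! ### Elements of low rank -/

theorem isDiag_conj_of_eq {U : Matrix (Fin n) (Fin n) ℝ}
    (hU : U ∈ Matrix.orthogonalGroup (Fin n) ℝ) {B : Matrix (Fin n) (Fin n) ℂ} {d : Fin n → ℂ}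
    (hB : B = U.transpose.complexify * Matrix.diagonal d * U.complexify) :
    (U.complexify * B * U.complexify.transpose).IsDiag := by
  have h1 : U.complexify * U.transpose.complexify = 1 := by
    rw [← Matrix.complexify_mul, (Matrix.mem_orthogonalGroup_iff _ _).1 hU, Matrix.complexify_one]
  rw [hB, show U.complexify * (U.transpose.complexify * Matrix.diagonal d * U.complexify) *
    U.complexify.transpose = (U.complexify * U.transpose.complexify) * Matrix.diagonal d *
    (U.complexify * U.transpose.complexify) by simp only [Matrix.mul_assoc]; rfl, h1,
    Matrix.one_mul, Matrix.mul_one]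
  exact Matrix.isDiag_diagonal d

/-- The Schur complement of the identity block of a matrix of rank at most `n` vanishes. -/
theorem eq_mul_of_rank_le {W : Matrix (Fin 2 × Fin n) (Fin 2 × Fin n) ℂ} (hr : W.rank ≤ n)
    (h00 : matBlock W 0 0 = 1) : matBlock W 1 1 = matBlock W 1 0 * matBlock W 0 1 := by
  have hpair : ∀ X : Fin 2 × Fin n → ℂ,
      X = pairVec (fun i => X (0, i)) (fun i => X (1, i)) := by
    intro X
    ext ⟨α, i⟩
    fin_cases α <;> rfl
  have hker : ∀ X ∈ LinearMap.ker W.mulVecLin,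
      ((fun i => X (0, i)) + (matBlock W 0 1).mulVec (fun i => X (1, i)) = 0) ∧
      ((matBlock W 1 0).mulVec (fun i => X (0, i)) +
        (matBlock W 1 1).mulVec (fun i => X (1, i)) = 0) := by
    intro X hX
    rw [LinearMap.mem_ker, Matrix.mulVecLin_apply, hpair X, mulVec_pairVec, h00,
      Matrix.one_mulVec] at hX
    exact ⟨funext fun i => congrFun hX (0, i), funext fun i => congrFun hX (1, i)⟩
  -- On the kernel the lower half x determines the upper half -Cx, so `f` is injective. The rank
  -- bound gives a kernel of dimension at least n, so every x occurs, and the lower block row reads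
  -- Dx = C*Cx.
  let f : LinearMap.ker W.mulVecLin →ₗ[ℂ] (Fin n → ℂ) :=
    (LinearMap.funLeft ℂ ℂ fun i : Fin n => ((1 : Fin 2), i)) ∘ₗ Submodule.subtype _
  have hf : ∀ X, f X = fun i => X.1 (1, i) := fun X => rfl
  have hinj : Function.Injective f := by
    rw [← LinearMap.ker_eq_bot, LinearMap.ker_eq_bot']
    intro X hX
    rw [hf] at hX
    have h1 := (hker X.1 X.2).1
    rw [hX, Matrix.mulVec_zero, add_zero] at h1
    ext1
    rw [hpair X.1, h1, hX]
    ext ⟨α, i⟩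
    fin_cases α <;> rfl
  have h1 := W.mulVecLin.finrank_range_add_finrank_ker
  have h2 := LinearMap.finrank_le_finrank_of_injective hinj
  have h3 : Module.finrank ℂ (LinearMap.range W.mulVecLin) ≤ n := hr
  simp only [Module.finrank_fintype_fun_eq_card, Fintype.card_prod, Fintype.card_fin] at h1 h2
  have hsurj : Function.Surjective f :=
    (LinearMap.injective_iff_surjective_of_finrank_eq_finrank (by
      rw [Module.finrank_fintype_fun_eq_card, Fintype.card_fin]; omega)).1 hinj
  refine Matrix.ext_of_mulVec_single fun i => ?_
  obtain ⟨X, hX⟩ := hsurj (Pi.single i 1)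
  rw [hf] at hX
  obtain ⟨h4, h5⟩ := hker X.1 X.2
  rw [eq_neg_of_add_eq_zero_left h4, hX, Matrix.mulVec_neg, Matrix.mulVec_mulVec,
    neg_add_eq_zero] at h5
  exact h5.symm

theorem blocksSimultaneouslyDiagonalizable_of_rank_le
    {W : Matrix (Fin 2 × Fin n) (Fin 2 × Fin n) ℂ} (hW : W.PosSemidef) (hs : HasSymmBlocks W)
    (hr : W.rank ≤ n) (h00 : matBlock W 0 0 = 1) : BlocksSimultaneouslyDiagonalizable W := by
  have h := eq_mul_of_rank_le hr h00
  obtain ⟨-, P, Q, D, -, hP, hQ, -, -, h01, h10, h11⟩ := exists_blocks hW.isHermitian hs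
  have hDe := h
  rw [h11, h10, h01] at hDe
  obtain ⟨U, hU, p, q, rfl, rfl⟩ := exists_orthogonal_diagonalizing_pair hP hQ
    (commute_of_mul_eq_complexify hDe)
  have hU1 : U * U.transpose = 1 := (Matrix.mem_orthogonalGroup_iff _ _).1 hU
  have hU3 : U.complexify * U.transpose.complexify = 1 := by
    rw [← Matrix.complexify_mul, hU1, Matrix.complexify_one]
  rw [sub_eq_add_neg, ← neg_smul, complexify_diagonalized] at h10
  rw [complexify_diagonalized] at h01
  refine ⟨U, hU, fun α β => ?_⟩
  fin_cases α <;> fin_cases β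
  · refine isDiag_conj_of_eq hU (d := fun _ => 1) ?_
    rw [Matrix.diagonal_one, Matrix.mul_one, ← Matrix.complexify_mul, mul_eq_one_comm.1 hU1,
      Matrix.complexify_one]
    exact h00
  · exact isDiag_conj_of_eq hU h01
  · exact isDiag_conj_of_eq hU h10
  · refine isDiag_conj_of_eq hU (d := fun i => ((p i : ℂ) + -Complex.I * q i) *
      ((p i : ℂ) + Complex.I * q i)) (h.trans ?_)
    rw [h10, h01, show ∀ d d' : Fin n → ℂ, U.transpose.complexify * Matrix.diagonal d *
      U.complexify * (U.transpose.complexify * Matrix.diagonal d' * U.complexify) =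
      U.transpose.complexify * (Matrix.diagonal d * (U.complexify *
      U.transpose.complexify) * Matrix.diagonal d') * U.complexify by
        intro d d'; simp only [Matrix.mul_assoc], hU3, Matrix.mul_one,
      Matrix.diagonal_mul_diagonal]

/-! ### Generators of extreme rays -/

theorem mem_Gamma4_iff {w : HermSpace 2 ⊗[ℝ] SymSpace n} :
    w ∈ Gamma4 n ↔ (kronRep 2 n w).PosSemidef :=
  isPPT_kronRep_iff w

/-- Faces are tested on midpoints, and w is the midpoint of 2a and 2b; hence 2a lies in the
one-dimensional span of the ray. -/
theorem GeneratesExtremeRay.exists_smul_eq {V : Type*} [AddCommGroup V] [Module ℝ V] {K : Set V}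
    {w : V} (hw : GeneratesExtremeRay K w) {a b : V} (ha : (2 : ℝ) • a ∈ K)
    (hb : (2 : ℝ) • b ∈ K) (hab : a + b = w) : ∃ c : ℝ, c • w = a := by
  obtain ⟨R, ⟨⟨-, hface⟩, hdim⟩, hwR, hw0⟩ := hw
  have h1 : (2 : ℝ) • a ∈ R := (hface _ ha _ hb (by
    rw [← smul_add, smul_smul, hab]
    norm_num
    exact hwR)).1
  obtain ⟨c, hc⟩ := exists_smul_eq_of_finrank_eq_one hdim
    (x := (⟨w, Submodule.subset_span hwR⟩ : Submodule.span ℝ R))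
    (fun h => hw0 (congrArg Subtype.val h)) ⟨_, Submodule.subset_span h1⟩
  have hc' : c • w = (2 : ℝ) • a := congrArg Subtype.val hc
  refine ⟨2⁻¹ * c, ?_⟩
  rw [mul_smul, hc', smul_smul]
  norm_num

/-- A real PSD matrix is a sum of PSD matrices of rank at most one. -/
theorem exists_sum_rank_one {y : SymSpace n} (hy : y ∈ symPSD n) :
    ∃ Y : Fin n → SymSpace n, (∀ i, Y i ∈ symPSD n ∧ ∃ a b : Fin n → ℝ,
      (Y i : Matrix (Fin n) (Fin n) ℝ) = Matrix.vecMulVec a b) ∧ y = ∑ i, Y i := by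
  obtain ⟨U, hU, d, hd⟩ := exists_orthogonal_diagonalizing (SymSpace.isSymm y)
  have hU1 : U * U.transpose = 1 := (Matrix.mem_orthogonalGroup_iff _ _).1 hU
  have hd0 : ∀ i, 0 ≤ d i := by
    have h : (y : Matrix (Fin n) (Fin n) ℝ).PosSemidef := hy
    have h := h.mul_mul_conjTranspose_same U
    rw [Matrix.conjTranspose_eq_transpose_of_trivial, hd,
      show U * (U.transpose * Matrix.diagonal d * U) * U.transpose =
        (U * U.transpose) * Matrix.diagonal d * (U * U.transpose) by simp only [Matrix.mul_assoc],
      hU1, Matrix.one_mul, Matrix.mul_one, Matrix.posSemidef_diagonal_iff] at h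
    exact h
  have hpsd : ∀ i, (d i • Matrix.vecMulVec (U i) (U i)).PosSemidef := fun i => by
    have := (Matrix.posSemidef_vecMulVec_self_star (U i)).smul (hd0 i)
    simpa using this
  refine ⟨fun i => ⟨_, (hpsd i).isHermitian⟩, fun i => ⟨hpsd i, d i • U i, U i, ?_⟩, ?_⟩
  · rw [Matrix.smul_vecMulVec]
  · ext j k
    have hjk := congrFun (congrFun hd j) k
    rw [hjk]
    simp [Matrix.mul_apply, Matrix.diagonal_apply, Matrix.sum_apply, Matrix.vecMulVec_apply]
    exact Finset.sum_congr rfl fun i _ => by ring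

/-- Decompose w into products with second factor of rank at most one. By extremality any nonzero
summand is a multiple of w. -/
theorem GeneratesExtremeRay.exists_eq_tmul (hΓ : Gamma4 n = Sigma4 n)
    {w : HermSpace 2 ⊗[ℝ] SymSpace n} (hw : GeneratesExtremeRay (Gamma4 n) w) :
    ∃ (x : HermSpace 2) (y : SymSpace n) (a b : Fin n → ℝ), w = x ⊗ₜ[ℝ] y ∧
      (y : Matrix (Fin n) (Fin n) ℝ) = Matrix.vecMulVec a b := by
  have hwS : w ∈ Sigma4 n := by
    obtain ⟨R, ⟨⟨hR, -⟩, -⟩, hwR, -⟩ := id hw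
    rw [← hΓ]
    exact hR hwR
  have hw0 : w ≠ 0 := by
    obtain ⟨R, -, -, h⟩ := hw
    exact h
  obtain ⟨N, p, x, x', hp, hx, hx', hsum⟩ := hwS
  choose Y hY hYsum using fun l => exists_sum_rank_one (hx' l)
  let t : Fin N × Fin n → HermSpace 2 ⊗[ℝ] SymSpace n := fun q => (p q.1 • x q.1) ⊗ₜ[ℝ] Y q.1 q.2
  have ht : ∀ q, (kronRep 2 n (t q)).PosSemidef := fun q => by
    rw [kronRep_tmul]
    exact ((hx q.1).smul (hp q.1).le).kronecker (hY q.1 q.2).1.complexify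
  have hwt : w = ∑ q, t q := by
    rw [hsum, Fintype.sum_prod_type]
    refine Finset.sum_congr rfl fun l _ => ?_
    rw [hYsum l, TensorProduct.smul_tmul', TensorProduct.tmul_sum]
  obtain ⟨q, -, hq⟩ : ∃ q ∈ Finset.univ, t q ≠ 0 := by
    rw [hwt] at hw0
    exact Finset.exists_ne_zero_of_sum_ne_zero hw0
  obtain ⟨c, hc⟩ := hw.exists_smul_eq (a := t q) (b := ∑ r ∈ Finset.univ.erase q, t r)
    (by
      rw [mem_Gamma4_iff, map_smul]
      exact (ht q).smul zero_le_two)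
    (by
      rw [mem_Gamma4_iff, map_smul, map_sum]
      exact (Matrix.posSemidef_sum _ fun r _ => ht r).smul zero_le_two)
    (by rw [Finset.add_sum_erase _ _ (Finset.mem_univ q), hwt])
  have hc0 : c ≠ 0 := by
    rintro rfl
    exact hq (by rw [← hc, zero_smul])
  obtain ⟨a, b, hab⟩ := (hY q.1 q.2).2
  refine ⟨c⁻¹ • p q.1 • x q.1, Y q.1 q.2, a, b, ?_, hab⟩
  rw [← TensorProduct.smul_tmul', ← inv_smul_smul₀ hc0 w, hc]

/-- A second factor a bᵀ lets the Kronecker product factor through the m-dimensional space; for m =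
2 this gives rank at most 2. -/
theorem rank_kronecker_vecMulVec_le (x : Matrix (Fin m) (Fin m) ℂ) (a b : Fin n → ℝ) :
    (x ⊗ₖ (Matrix.vecMulVec a b).complexify).rank ≤ m := by
  let A : Matrix (Fin m × Fin n) (Fin m) ℂ := Matrix.of fun p β => x p.1 β * a p.2
  let B : Matrix (Fin m) (Fin m × Fin n) ℂ := Matrix.of fun β q => if β = q.1 then (b q.2 : ℂ) else 0
  have h : x ⊗ₖ (Matrix.vecMulVec a b).complexify = A * B := by
    ext ⟨α, i⟩ ⟨β, j⟩
    simp [A, B, Matrix.mul_apply, Matrix.vecMulVec_apply, mul_assoc]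
  rw [h]
  exact (Matrix.rank_mul_le_left A B).trans (A.rank_le_card_width.trans (Fintype.card_fin m).le)

theorem blocksSimultaneouslyDiagonalizable_tmul (x : HermSpace m) (y : SymSpace n) :
    BlocksSimultaneouslyDiagonalizable (kronRep m n (x ⊗ₜ[ℝ] y)) := by
  obtain ⟨U, hU, d, hd⟩ := exists_orthogonal_diagonalizing (SymSpace.isSymm y)
  refine ⟨U, hU, fun α β => isDiag_conj_of_eq hU
    (d := (x : Matrix (Fin m) (Fin m) ℂ) α β • fun i => (d i : ℂ)) ?_⟩
  rw [Matrix.diagonal_smul, Matrix.mul_smul, Matrix.smul_mul, ← Matrix.complexify_diagonal,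
    ← Matrix.complexify_mul, ← Matrix.complexify_mul, ← hd]
  rfl

end

theorem mainTheorem8 :
    -- the PPT cone and the separable cone coincide
    Gamma4 3 = Sigma4 3 ∧
    -- an element of `H(2) ⊗ S(3)` is separable if and only if it is PSD
    (∀ w : HermSpace 2 ⊗[ℝ] SymSpace 3,
      IsSeparableTensor (hermPSD 2) (symPSD 3) w ↔ (kronRep 2 3 w).PosSemidef) ∧
    -- generators of extreme rays have rank at most 3, and on their whole orbit under
    -- `Aut(H₊(2)) × Aut(S₊(3))` the four blocks are simultaneously diagonalizable
    (∀ w : HermSpace 2 ⊗[ℝ] SymSpace 3, GeneratesExtremeRay (Gamma4 3) w →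
      (kronRep 2 3 w).rank ≤ 3 ∧
      ∀ (g : HermSpace 2 ≃ₗ[ℝ] HermSpace 2) (g' : SymSpace 3 ≃ₗ[ℝ] SymSpace 3),
        IsConeAut (hermPSD 2) g → IsConeAut (symPSD 3) g' →
        BlocksSimultaneouslyDiagonalizable (kronRep 2 3 (TensorProduct.congr g g' w))) ∧
    -- every element of rank at most 3 normalized to have upper left block `I₃`
    -- has simultaneously diagonalizable blocks
    (∀ w ∈ Gamma4 3, (kronRep 2 3 w).rank ≤ 3 → matBlock (kronRep 2 3 w) 0 0 = 1 →
      BlocksSimultaneouslyDiagonalizable (kronRep 2 3 w)) := by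
  have hΓ : Gamma4 3 = Sigma4 3 := by
    ext w
    exact mem_Gamma4_iff.trans (isSeparableTensor_iff_posSemidef w).symm
  refine ⟨hΓ, isSeparableTensor_iff_posSemidef, fun w hw => ?_, fun w hw hr h00 =>
    blocksSimultaneouslyDiagonalizable_of_rank_le hw.1 (hasSymmBlocks_kronRep w) hr h00⟩
  obtain ⟨x, y, a, b, rfl, hy⟩ := hw.exists_eq_tmul hΓ
  refine ⟨?_, fun g g' _ _ => ?_⟩
  · rw [kronRep_tmul, hy]
    exact (rank_kronecker_vecMulVec_le _ a b).trans (by norm_num)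
  · rw [TensorProduct.congr_tmul]
    exact blocksSimultaneouslyDiagonalizable_tmul _ _
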